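/- Let $A=\bigoplus_{j\ge 0}A_j$ be a commutative graded $\mathbb Z$-algebra with identity such that every $A_j$ is a free abelian group of finite rank. Suppose that $A$ is pointed: as an abelian group $A=\mathbb Z 1\oplus A'$ for a subgroup $A'$ all of whose nonzero homogeneous elements have degree at least $1$. Let $G$ be a finite graph (loops and multiple edges are allowed) with $v$ vertices and $\mu$ connected components. Fix a linear order on the edge set $E$ of $G$. For $s\subseteq E$ let $[G:s]$ be the graph with the vertices of $G$ and edge set $s$, and let $C^s(G)=A^{\otimes k(s)}$ (tensor product over $\mathbb Z$) have one tensor factor for each of the $k(s)$ connected components of $[G:s]$, with the grading induced from $A$. Put $C^i(G)=\bigoplus_{|s|=i}C^s(G)$ and let $d^i\colon C^i(G)\to C^{i+1}(G)$ be the sum, over all $s$ with $|s|=i$ and all $e\in E\setminus s$, of $(-1)^{n(s,e)}d_{s,e}$, where $n(s,e)$ is the number of elements of $s$ that precede $e$, and $d_{s,e}\colon C^s(G)\to C^{s\cup\{e\}}(G)$ is the identity if $e$ joins a component of $[G:s]$ to itself, while if $e$ joins two different components it multiplies the two corresponding tensor factors and is the identity on the others. This is a cochain complex with a degree-preserving differential;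 let $C^{i,j}(G)$ be the degree-$j$ part of $C^i(G)$ and let $$H_A^{i,j}(G)=\frac{\ker\bigl(d^i\colon C^{i,j}(G)\to C^{i+1,j}(G)\bigr)}{\operatorname{im}\bigl(d^{i-1}\colon C^{i-1,j}(G)\to C^{i,j}(G)\bigr)}\qquad(i,j\ge 0,\ C^{-1,j}(G)=0).$$ Then for all $i,j\ge 0$: (a) if $H_A^{i,j}(G)\neq 0$, then $i+j\ge v-\mu$; (b) if the torsion subgroup of $H_A^{i,j}(G)$ is nonzero, then $i+j\ge v-\mu+1$. -/

import Mathlib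

open scoped TensorProduct

noncomputable section

namespace ChromaticCohomology

/-! ### Connected components of a multigraph -/

/-- The set of connected components of a multigraph (loops and multiple edges are allowed):
vertices modulo the equivalence relation generated by adjacency. -/
def Component {α β : Type*} (H : Graph α β) : Type _ :=
  Quot (fun x y : H.vertexSet => H.Adj x.1 y.1)

instance instFiniteComponent {α β : Type*} (H : Graph α β) [Finite H.vertexSet] :
    Finite (Component H) :=
  inferInstanceAs (Finite (Quot _))

instance instFiniteVertexSetRestrict {α β : Type*} (G : Graph α β) [h : Finite G.vertexSet]
    (s : Set β) : Finite (G.restrict s).vertexSet :=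
  h

/-- A component of a subgraph `H` of `K` is contained in exactly one component of `K`. -/
def Component.map {α β : Type*} {H K : Graph α β} (h : H ≤ K) : Component H → Component K :=
  Quot.map (fun x => ⟨x.1, h.vertexSet_mono x.2⟩) (fun _ _ hxy => hxy.mono h)

theorem Component.map_map {α β : Type*} {H K L : Graph α β} (h : H ≤ K) (k : K ≤ L)
    (c : Component H) : Component.map k (Component.map h c) = Component.map (h.trans k) c := by
  induction c using Quot.ind
  rfl

/-! ### Tensor powers of a commutative algebra

The constructions are made over a commutative ring `R` of coefficients; graded `ℤ`-algebras are the
case `R = ℤ`. -/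

open Classical in
/-- Changing the `i`-th entry of `a` only changes the product over the fibre of `f i`. -/
theorem prod_fiber_update {ι κ A : Type*} [CommRing A] [Fintype ι] [DecidableEq ι] (f : ι → κ)
    (a : ι → A) (i : ι) (x : A) :
    (fun k => ∏ i' with f i' = k, Function.update a i x i') =
      Function.update (fun k => ∏ i' with f i' = k, a i') (f i)
        (x * ∏ i' ∈ (Finset.univ.filter fun i' => f i' = f i).erase i, a i') := by
  funext k
  by_cases hk : k = f i
  · subst hk
    rw [Function.update_self,
      ← Finset.mul_prod_erase (Finset.univ.filter fun i' => f i' = f i) _ (a := i) (by simp),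
      Function.update_self]
    congr 1
    refine Finset.prod_congr rfl fun j hj => ?_
    rw [Function.update_of_ne (Finset.ne_of_mem_erase hj)]
  · rw [Function.update_of_ne hk]
    refine Finset.prod_congr rfl fun j hj => ?_
    rw [Function.update_of_ne]
    rintro rfl
    exact hk (Finset.mem_filter.1 hj).2.symm

open Classical in
/-- The linear map `A^{⊗ι} → A^{⊗κ}` induced by a map `f : ι → κ` of finite index sets: it sends
`⨂ᵢ aᵢ` to `⨂ₖ ∏_{f i = k} aᵢ`. When `f` is a bijection it merely relabels the tensor factors;
when `f` is surjective and identifies exactly two indices `i₁, i₂`, it multiplies the factors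
`i₁` and `i₂` together and is the identity on the remaining ones. -/
def mergeMul {ι κ : Type*} (R A : Type*) [CommRing R] [CommRing A] [Algebra R A]
    [Finite ι] (f : ι → κ) :
    (⨂[R] _ : ι, A) →ₗ[R] (⨂[R] _ : κ, A) :=
  letI := Fintype.ofFinite ι
  PiTensorProduct.lift
    { toFun := fun a => PiTensorProduct.tprod R fun k => ∏ i with f i = k, a i
      map_update_add' := by
        intro _ a i x y
        simp only [prod_fiber_update, add_mul, MultilinearMap.map_update_add]
      map_update_smul' := by
        intro _ a i c x
        simp only [prod_fiber_update, smul_mul_assoc, MultilinearMap.map_update_smul] }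

open Classical in
theorem mergeMul_tprod {ι κ R A : Type*} [CommRing R] [CommRing A] [Algebra R A]
    [Fintype ι] (f : ι → κ) (a : ι → A) :
    mergeMul R A f (PiTensorProduct.tprod R a) =
      PiTensorProduct.tprod R fun k => ∏ i with f i = k, a i := by
  rw [mergeMul, PiTensorProduct.lift.tprod]
  simp only [MultilinearMap.coe_mk]
  congr 1
  funext k
  exact Finset.prod_congr (Finset.ext fun i => by simp) fun _ _ => rfl

theorem mergeMul_mergeMul {ι κ l R A : Type*} [CommRing R] [CommRing A] [Algebra R A]
    [Finite ι] [Finite κ] (f : ι → κ)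
    (g : κ → l) (x : ⨂[R] _ : ι, A) :
    mergeMul R A g (mergeMul R A f x) = mergeMul R A (g ∘ f) x := by
  classical
  cases nonempty_fintype ι
  cases nonempty_fintype κ
  suffices h : mergeMul R A g ∘ₗ mergeMul R A f = mergeMul R A (g ∘ f) from LinearMap.congr_fun h x
  ext a
  simp only [LinearMap.compMultilinearMap_apply, LinearMap.comp_apply, mergeMul_tprod]
  congr 1
  funext k
  rw [Finset.prod_sigma']
  refine Finset.prod_bij' (fun p _ => p.2) (fun i _ => ⟨f i, i⟩) ?_ ?_ ?_ ?_ ?_ <;> aesop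

/-- The homogeneous elements of degree `j` in `A^{⊗ι}`: the span of the pure tensors `⨂ᵢ aᵢ` with
`aᵢ` homogeneous of degree `deg i` and `∑ᵢ deg i = j`. -/
def tensorDegree {R A : Type*} [CommRing R] [CommRing A] [Algebra R A]
    (𝒜 : ℕ → Submodule R A) (ι : Type*) [Finite ι] (j : ℕ) :
    Submodule R (⨂[R] _ : ι, A) :=
  Submodule.span R {x | ∃ (a : ι → A) (deg : ι → ℕ), (∀ i, a i ∈ 𝒜 (deg i)) ∧
    ∑ᶠ i, deg i = j ∧ x = PiTensorProduct.tprod R a}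

theorem mergeMul_mem_tensorDegree {R A : Type*} [CommRing R] [CommRing A] [Algebra R A]
    (𝒜 : ℕ → Submodule R A)
    [SetLike.GradedMonoid 𝒜] {ι κ : Type*} [Finite ι] [Finite κ] (f : ι → κ) {j : ℕ}
    {x : ⨂[R] _ : ι, A} (hx : x ∈ tensorDegree 𝒜 ι j) :
    mergeMul R A f x ∈ tensorDegree 𝒜 κ j := by
  classical
  cases nonempty_fintype ι
  cases nonempty_fintype κ
  refine (Submodule.span_le (p := (tensorDegree 𝒜 κ j).comap (mergeMul R A f))).2 ?_ hx
  rintro _ ⟨a, deg, ha, hj, rfl⟩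
  refine Submodule.subset_span ⟨_, fun k => ∑ i with f i = k, deg i, fun k => ?_, ?_,
    mergeMul_tprod f a⟩
  · exact SetLike.prod_mem_graded _ _ _ fun i _ => ha i
  · rw [finsum_eq_sum_of_fintype] at hj ⊢
    rw [← hj]
    exact Finset.sum_fiberwise _ _ _

/-! ### The cochain complex -/

/-- The vertices of height `i` of the cube `{0,1}^E`: sets of `i` edges of `G`. -/
abbrev EdgeSubset {α β : Type*} (G : Graph α β) (i : ℕ) : Type _ :=
  {s : Finset β // (s : Set β) ⊆ G.edgeSet ∧ s.card = i}

/-- The components of the spanning subgraph `[G : s]` (vertex set `V(G)`, edge set `s`). -/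
abbrev SpanningComponent {α β : Type*} (G : Graph α β) (s : Finset β) : Type _ :=
  Component (G.restrict (s : Set β))

/-- The cochain group `Cⁱ(G) = ⨁_{|s| = i} A^{⊗ components of [G : s]}`; for a finite graph the
direct sum is a finite one and is written as a product. -/
abbrev Cochain {α β : Type*} (R A : Type*) [CommRing R] [CommRing A] [Algebra R A]
    (G : Graph α β) (i : ℕ) : Type _ :=
  (s : EdgeSubset G i) → ⨂[R] _ : SpanningComponent G s.1, A

/-- The per-edge map `A^{⊗ components of [G : s]} → A^{⊗ components of [G : t]}` of the cube, for
`s ⊆ t`: if `t = s ∪ {e}` and `e` joins a component of `[G : s]` to itself it is the identity, and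
if `e` joins two distinct components it multiplies their factors. -/
def edgeMap {α β : Type*} (R A : Type*) [CommRing R] [CommRing A] [Algebra R A]
    (G : Graph α β) [Finite G.vertexSet]
    {s t : Finset β} (h : s ⊆ t) :
    (⨂[R] _ : SpanningComponent G s, A) →ₗ[R] (⨂[R] _ : SpanningComponent G t, A) :=
  mergeMul R A (Component.map (G.restrict_mono_right (Finset.coe_subset.2 h)))

/-- The set `t` with its edge `e` removed. -/
def EdgeSubset.erase {α β : Type*} [LinearOrder β] {G : Graph α β} {i : ℕ}
    (t : EdgeSubset G (i + 1)) (e : β) (he : e ∈ t.1) : EdgeSubset G i :=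
  ⟨t.1.erase e, (Finset.coe_subset.2 (t.1.erase_subset e)).trans t.2.1, by
    rw [Finset.card_erase_of_mem he, t.2.2, Nat.add_sub_cancel]⟩

theorem EdgeSubset.erase_subset {α β : Type*} [LinearOrder β] {G : Graph α β} {i : ℕ}
    (t : EdgeSubset G (i + 1)) (e : β) (he : e ∈ t.1) : (t.erase e he).1 ⊆ t.1 :=
  Finset.erase_subset _ _

/-- The differential `dⁱ : Cⁱ(G) → Cⁱ⁺¹(G)`, the signed sum of the per-edge maps. The sign of the
cube edge from `t \ {e}` to `t` is `(-1)^k`, with `k` the number of edges of `t` before `e`. -/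
def differential {α β : Type*} [LinearOrder β] (R A : Type*) [CommRing R] [CommRing A] [Algebra R A]
    (G : Graph α β)
    [Finite G.vertexSet] (i : ℕ) : Cochain R A G i →ₗ[R] Cochain R A G (i + 1) :=
  LinearMap.pi fun t => ∑ e : {e // e ∈ t.1},
    ((-1 : R) ^ (t.1.filter (· < e.1)).card) •
      (edgeMap R A G (t.erase_subset e.1 e.2) ∘ₗ LinearMap.proj (t.erase e.1 e.2))

/-- `C^{i,j}(G)`: the homogeneous elements of degree `j` of `Cⁱ(G)`. -/
def homogeneousCochains {α β R A : Type*} [CommRing R] [CommRing A] [Algebra R A]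
    (𝒜 : ℕ → Submodule R A) (G : Graph α β)
    [Finite G.vertexSet] (i j : ℕ) : Submodule R (Cochain R A G i) :=
  Submodule.pi Set.univ fun s => tensorDegree 𝒜 (SpanningComponent G s.1) j

/-- The cocycles in `C^{i,j}(G)`. -/
def cocycles {α β R A : Type*} [LinearOrder β] [CommRing R] [CommRing A] [Algebra R A]
    (𝒜 : ℕ → Submodule R A)
    (G : Graph α β) [Finite G.vertexSet] (i j : ℕ) : Submodule R (Cochain R A G i) :=
  homogeneousCochains 𝒜 G i j ⊓ LinearMap.ker (differential R A G i)

/-- The coboundaries in `C^{i,j}(G)`: the image of `C^{i-1,j}(G)`, which is zero for `i = 0`. -/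
def coboundaries {α β R A : Type*} [LinearOrder β] [CommRing R] [CommRing A] [Algebra R A]
    (𝒜 : ℕ → Submodule R A)
    (G : Graph α β) [Finite G.vertexSet] : (i j : ℕ) → Submodule R (Cochain R A G i)
  | 0, _ => ⊥
  | i + 1, j => (homogeneousCochains 𝒜 G i j).map (differential R A G i)

/-- The chromatic cohomology group `H^{i,j}_A(G)`: cocycles modulo coboundaries
(see `coboundaries_le_cocycles`). -/
abbrev Cohomology {α β R A : Type*} [LinearOrder β] [CommRing R] [CommRing A] [Algebra R A]
    (𝒜 : ℕ → Submodule R A)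
    (G : Graph α β) [Finite G.vertexSet] (i j : ℕ) : Type _ :=
  cocycles 𝒜 G i j ⧸ (coboundaries 𝒜 G i j).submoduleOf (cocycles 𝒜 G i j)

/-! ### The differential is homogeneous and squares to zero -/

theorem differential_apply {α β R A : Type*} [LinearOrder β] [CommRing R] [CommRing A] [Algebra R A]
    (G : Graph α β)
    [Finite G.vertexSet] (i : ℕ) (x : Cochain R A G i) (t : EdgeSubset G (i + 1)) :
    differential R A G i x t = ∑ e : {e // e ∈ t.1},
      ((-1 : R) ^ (t.1.filter (· < e.1)).card) •
        edgeMap R A G (t.erase_subset e.1 e.2) (x (t.erase e.1 e.2)) := by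
  simp only [differential, LinearMap.pi_apply, LinearMap.sum_apply, LinearMap.smul_apply,
    LinearMap.comp_apply, LinearMap.proj_apply]

theorem edgeMap_edgeMap {α β R A : Type*} [CommRing R] [CommRing A] [Algebra R A]
    (G : Graph α β) [Finite G.vertexSet]
    {s t u : Finset β} (h : s ⊆ t) (k : t ⊆ u) (x : ⨂[R] _ : SpanningComponent G s, A) :
    edgeMap R A G k (edgeMap R A G h x) = edgeMap R A G (h.trans k) x := by
  rw [edgeMap, edgeMap, mergeMul_mergeMul, edgeMap]
  congr 2
  funext c
  exact Component.map_map _ _ c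

theorem edgeMap_congr {α β R A : Type*} [CommRing R] [CommRing A] [Algebra R A]
    (G : Graph α β) [Finite G.vertexSet] {i : ℕ}
    (x : Cochain R A G i) {s s' : EdgeSubset G i} (hs : s = s') {u : Finset β} (h : s.1 ⊆ u)
    (h' : s'.1 ⊆ u) : edgeMap R A G h (x s) = edgeMap R A G h' (x s') := by
  subst hs
  rfl

theorem sign_swap (R : Type*) [CommRing R] {β : Type*} [LinearOrder β] (t : Finset β) {e f : β} (he : e ∈ t) (hf : f ∈ t)
    (hef : e ≠ f) :
    ((-1 : R) ^ (t.filter (· < e)).card) * (-1) ^ ((t.erase e).filter (· < f)).card =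
      -(((-1 : R) ^ (t.filter (· < f)).card) * (-1) ^ ((t.erase f).filter (· < e)).card) := by
  wlog h : e < f generalizing e f
  · rw [this hf he hef.symm (lt_of_le_of_ne (not_lt.1 h) hef.symm), neg_neg]
  have h1 : (t.erase f).filter (· < e) = t.filter (· < e) := by
    ext x
    simp only [Finset.mem_filter, Finset.mem_erase]
    exact ⟨fun hx => ⟨hx.1.2, hx.2⟩, fun hx => ⟨⟨(hx.2.trans h).ne, hx.1⟩, hx.2⟩⟩
  have h2 : (t.filter (· < f)).card = ((t.erase e).filter (· < f)).card + 1 := by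
    rw [Finset.filter_erase, Finset.card_erase_add_one]
    simp [he, h]
  rw [h1, h2, pow_succ]
  ring

theorem differential_differential_apply {α β R A : Type*} [LinearOrder β]
    [CommRing R] [CommRing A] [Algebra R A]
    (G : Graph α β) [Finite G.vertexSet] (i : ℕ) (x : Cochain R A G i)
    (t : EdgeSubset G (i + 1 + 1)) :
    differential R A G (i + 1) (differential R A G i x) t =
      ∑ p : (e : {e // e ∈ t.1}) × {f // f ∈ (t.erase e.1 e.2).1},
        (((-1 : R) ^ (t.1.filter (· < p.1.1)).card) *
          (-1) ^ ((t.1.erase p.1.1).filter (· < p.2.1)).card) •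
        edgeMap R A G (((t.erase p.1.1 p.1.2).erase_subset p.2.1 p.2.2).trans
          (t.erase_subset p.1.1 p.1.2)) (x ((t.erase p.1.1 p.1.2).erase p.2.1 p.2.2)) := by
  rw [differential_apply, Fintype.sum_sigma]
  refine Finset.sum_congr rfl fun e _ => ?_
  rw [differential_apply, map_sum, Finset.smul_sum]
  refine Finset.sum_congr rfl fun f _ => ?_
  rw [map_smul, edgeMap_edgeMap, smul_smul]
  rfl

theorem smul_add_smul_eq_zero {R M : Type*} [CommRing R] [AddCommMonoid M] [Module R M] {a b : R}
    {m m' : M} (h : a = -b) (hm : m = m') : a • m + b • m' = 0 := by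
  rw [hm, ← add_smul, h, neg_add_cancel, zero_smul]

theorem differential_differential {α β R A : Type*} [LinearOrder β]
    [CommRing R] [CommRing A] [Algebra R A] (G : Graph α β)
    [Finite G.vertexSet] (i : ℕ) (x : Cochain R A G i) :
    differential R A G (i + 1) (differential R A G i x) = 0 := by
  funext t
  rw [differential_differential_apply]
  refine Finset.sum_involution
    (fun p _ => ⟨⟨p.2.1, Finset.mem_of_mem_erase p.2.2⟩,
      ⟨p.1.1, Finset.mem_erase.2 ⟨(Finset.ne_of_mem_erase p.2.2).symm, p.1.2⟩⟩⟩) ?_ ?_ ?_ ?_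
  · rintro ⟨⟨e, he⟩, ⟨f, hf⟩⟩ -
    have hne : e ≠ f := (Finset.ne_of_mem_erase hf).symm
    have hft : f ∈ t.1 := Finset.mem_of_mem_erase hf
    have hef : e ∈ (t.erase f hft).1 := Finset.mem_erase.2 ⟨hne, he⟩
    have hs : (t.erase e he).erase f hf = (t.erase f hft).erase e hef :=
      Subtype.ext Finset.erase_right_comm
    have h1 := sign_swap R t.1 he hft hne
    have h2 := edgeMap_congr G x hs
      (((t.erase e he).erase_subset f hf).trans (t.erase_subset e he))
      (((t.erase f hft).erase_subset e hef).trans (t.erase_subset f hft))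
    exact smul_add_smul_eq_zero h1 h2
  · rintro ⟨⟨e, he⟩, ⟨f, hf⟩⟩ - - heq
    exact Finset.ne_of_mem_erase hf (congrArg (fun p => p.1.1) heq)
  · intros
    exact Finset.mem_univ _
  · rintro ⟨⟨e, he⟩, ⟨f, hf⟩⟩ -
    rfl

theorem differential_mem_homogeneousCochains {α β R A : Type*} [LinearOrder β]
    [CommRing R] [CommRing A] [Algebra R A]
    (𝒜 : ℕ → Submodule R A) [SetLike.GradedMonoid 𝒜] (G : Graph α β) [Finite G.vertexSet]
    {i j : ℕ} {x : Cochain R A G i} (hx : x ∈ homogeneousCochains 𝒜 G i j) :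
    differential R A G i x ∈ homogeneousCochains 𝒜 G (i + 1) j := by
  intro t _
  rw [differential_apply]
  exact Submodule.sum_mem _ fun e _ => Submodule.smul_mem _ _
    (mergeMul_mem_tensorDegree 𝒜 _ (hx _ (Set.mem_univ _)))

theorem coboundaries_le_cocycles {α β R A : Type*} [LinearOrder β]
    [CommRing R] [CommRing A] [Algebra R A]
    (𝒜 : ℕ → Submodule R A) [SetLike.GradedMonoid 𝒜] (G : Graph α β) [Finite G.vertexSet]
    (i j : ℕ) : coboundaries 𝒜 G i j ≤ cocycles 𝒜 G i j := by
  cases i with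
  | zero => exact bot_le
  | succ i =>
    rintro _ ⟨x, hx, rfl⟩
    exact ⟨differential_mem_homogeneousCochains 𝒜 G hx, differential_differential G i x⟩

/-- A graded algebra `A` is pointed if `A = R·1 ⊕ A'` for a submodule `A'` all of whose nonzero
homogeneous elements have degree at least `1`. -/
def IsPointed {R A : Type*} [CommRing R] [CommRing A] [Algebra R A]
    (𝒜 : ℕ → Submodule R A) : Prop :=
  ∃ A' : Submodule R A, IsCompl (Submodule.span R {(1 : A)}) A' ∧
    ∀ n, ∀ a ∈ A', a ∈ 𝒜 n → a ≠ 0 → 1 ≤ n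

end ChromaticCohomology

end

noncomputable section

namespace ChromaticCohomology

/-! ### Complexes of cubes of modules -/

/-! The bound is proved for a larger family of complexes, by induction on the number of edges. Fix a
scalar `n` and a set `W` of vertices. Only tensors of degree `j` with positive-degree entries at the
blocks meeting `W` are admitted, and everything is taken modulo `n`. Let `b` be the number of blocks
when no edge is used, and `f` the number of blocks missing `W` when all edges of `E` are used. The
claim, `cubeExact_of_lt`, is exactness in position `i` whenever `i + j + f < b`. For `W = ∅` and the
whole graph, `b` is the number of vertices and `f` the number of components.

Without edges, `b - f` blocks meet `W` and each costs a degree, so the group is zero. A loop makes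
two opposite faces of the cube isomorphic, so the total complex, a cone, is exact. If an edge is not
a bridge, or is a bridge with both sides meeting `W`, the long exact sequence of deletion and
contraction applies (`CubeExact.of_faces`): deletion does not raise `f`, while contraction lowers
`i` by one and `b` by at most one. In the remaining case every edge is a bridge with a side missing
`W`, and a minimal such side is a leaf (`exists_leaf`). Multiplication along the leaf edge is split
onto. Since degree zero consists of scalars, its kernel is a retract of the tensors with
positive-degree entry at the leaf. The leaf is therefore cut off and added to `W`
(`CubeExact.of_section`), and `f` does not grow.

Taking `n = 0` gives (a). For (b), if `n • x = d y`, then `y` is a cocycle modulo `n` one position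
lower, where vanishing still holds. Hence `y = c + n • w` with `c` a coboundary, so `n • x = n • d
w`, and `x = d w` because the cochains are torsion-free. -/

theorem map_cube_congr {β R : Type*} [CommRing R] {X : Finset β → Type*} [∀ s, AddCommGroup (X s)]
    [∀ s, Module R (X s)] {φ : ∀ s t : Finset β, s ⊆ t → X s →ₗ[R] X t} (x : ∀ s, X s) {s s' u : Finset β} (hs : s = s') (h : s ⊆ u)
    (h' : s' ⊆ u) : φ s u h (x s) = φ s' u h' (x s') := by
  subst hs
  rfl

section Cube

variable {β R : Type*} [LinearOrder β] [CommRing R] {X : Finset β → Type*}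
  [∀ s, AddCommGroup (X s)] [∀ s, Module R (X s)]

/-- The sign of the edge of the cube in direction `e` at the vertex `s`. -/
def cubeSign (R : Type*) [CommRing R] (s : Finset β) (e : β) : R :=
  (-1) ^ (s.filter (· < e)).card

theorem cubeSign_mul_self (s : Finset β) (e : β) : cubeSign R s e * cubeSign R s e = 1 := by
  rw [cubeSign, ← mul_pow, neg_one_mul, neg_neg, one_pow]

theorem cubeSign_insert_self (s : Finset β) (e : β) :
    cubeSign R (insert e s) e = cubeSign R s e := by
  rw [cubeSign, cubeSign, Finset.filter_insert, if_neg (lt_irrefl e)]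

theorem cubeSign_smul_smul {M : Type*} [AddCommGroup M] [Module R M] (s : Finset β) (e : β)
    (m : M) : cubeSign R s e • cubeSign R s e • m = m := by
  rw [smul_smul, cubeSign_mul_self, one_smul]

theorem cubeSign_smul_mem_iff {M : Type*} [AddCommGroup M] [Module R M] (N : Submodule R M)
    (s : Finset β) (e : β) (m : M) : cubeSign R s e • m ∈ N ↔ m ∈ N :=
  ⟨fun h => by simpa only [cubeSign_smul_smul] using N.smul_mem (cubeSign R s e) h,
    fun h => N.smul_mem _ h⟩

/-- On the face containing `e` the signs are those at `insert e s`. Rescaling by `cubeSign R s e`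
turns them into the signs of the smaller cube, up to the minus sign of a cone. -/
theorem cubeSign_mul_insert {s : Finset β} {e f : β} (he : e ∉ s) (hf : f ∈ s) :
    cubeSign R s e * cubeSign R (insert e s) f =
      -(cubeSign R s f * cubeSign R (s.erase f) e) := by
  have hef : e ≠ f := fun h => he (h ▸ hf)
  have h := sign_swap R (insert e s) (Finset.mem_insert_self e s) (Finset.mem_insert_of_mem hf) hef
  rw [Finset.erase_insert he, Finset.erase_insert_of_ne hef] at h
  change cubeSign R (insert e s) e * cubeSign R s f =
    -(cubeSign R (insert e s) f * cubeSign R (insert e (s.erase f)) e) at h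
  rw [cubeSign_insert_self, cubeSign_insert_self] at h
  have h2 : cubeSign R s e * cubeSign R (insert e s) f =
      (cubeSign R s e * cubeSign R s f) * (cubeSign R (insert e s) f * cubeSign R s f) := by
    linear_combination (-(cubeSign R s e * cubeSign R (insert e s) f)) * cubeSign_mul_self (R := R) s f
  rw [h] at h2
  rw [h2]
  linear_combination (-(cubeSign R (s.erase f) e * cubeSign R s f)) *
    cubeSign_mul_self (R := R) (insert e s) f

variable (φ : ∀ s t : Finset β, s ⊆ t → X s →ₗ[R] X t)

/-- The differential of the total complex of a cube. -/
def cubeD (x : ∀ s, X s) (t : Finset β) : X t :=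
  ∑ f : {f // f ∈ t}, cubeSign R t f.1 • φ (t.erase f.1) t (t.erase_subset f.1) (x (t.erase f.1))

variable {φ}

theorem cubeD_sub (x y : ∀ s, X s) (t : Finset β) :
    cubeD φ (x - y) t = cubeD φ x t - cubeD φ y t := by
  simp only [cubeD, Pi.sub_apply, map_sub, smul_sub, Finset.sum_sub_distrib]

theorem cubeD_add (x y : ∀ s, X s) (t : Finset β) :
    cubeD φ (x + y) t = cubeD φ x t + cubeD φ y t := by
  simp only [cubeD, Pi.add_apply, map_add, smul_add, Finset.sum_add_distrib]

theorem cubeD_congr {x y : ∀ s, X s} {t : Finset β} (h : ∀ f ∈ t, x (t.erase f) = y (t.erase f)) :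
    cubeD φ x t = cubeD φ y t :=
  Finset.sum_congr rfl fun f _ => by rw [h f.1 f.2]

theorem cubeD_eq_zero {x : ∀ s, X s} {t : Finset β} (h : ∀ f ∈ t, x (t.erase f) = 0) :
    cubeD φ x t = 0 :=
  Finset.sum_eq_zero fun f _ => by rw [h f.1 f.2, map_zero, smul_zero]

theorem cubeD_mem {L : ∀ s, Submodule R (X s)} (hL : ∀ s t h, ∀ x ∈ L s, φ s t h x ∈ L t)
    {x : ∀ s, X s} (hx : ∀ s, x s ∈ L s) (t : Finset β) : cubeD φ x t ∈ L t :=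
  Submodule.sum_mem _ fun _ _ => Submodule.smul_mem _ _ (hL _ _ _ _ (hx _))

theorem cubeD_cubeD (hφ : ∀ s t u h k x, φ t u k (φ s t h x) = φ s u (h.trans k) x)
    (x : ∀ s, X s) (t : Finset β) : cubeD φ (cubeD φ x) t = 0 := by
  have key : cubeD φ (cubeD φ x) t =
      ∑ p : (e : {e // e ∈ t}) × {f // f ∈ t.erase e.1},
        (cubeSign R t p.1.1 * cubeSign R (t.erase p.1.1) p.2.1) •
        φ ((t.erase p.1.1).erase p.2.1) t
          (((t.erase p.1.1).erase_subset p.2.1).trans (t.erase_subset p.1.1))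
          (x ((t.erase p.1.1).erase p.2.1)) := by
    rw [cubeD, Fintype.sum_sigma]
    refine Finset.sum_congr rfl fun e _ => ?_
    rw [cubeD, map_sum, Finset.smul_sum]
    refine Finset.sum_congr rfl fun f _ => ?_
    rw [map_smul, hφ, smul_smul]
  rw [key]
  refine Finset.sum_involution
    (fun p _ => ⟨⟨p.2.1, Finset.mem_of_mem_erase p.2.2⟩,
      ⟨p.1.1, Finset.mem_erase.2 ⟨(Finset.ne_of_mem_erase p.2.2).symm, p.1.2⟩⟩⟩) ?_ ?_ ?_ ?_
  · rintro ⟨⟨e, he⟩, ⟨f, hf⟩⟩ -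
    have hne : e ≠ f := (Finset.ne_of_mem_erase hf).symm
    exact smul_add_smul_eq_zero (sign_swap R t he (Finset.mem_of_mem_erase hf) hne)
      (map_cube_congr x Finset.erase_right_comm _ _)
  · rintro ⟨⟨e, he⟩, ⟨f, hf⟩⟩ - - heq
    exact Finset.ne_of_mem_erase hf (congrArg (fun p => p.1.1) heq)
  · intros
    exact Finset.mem_univ _
  · rintro ⟨⟨e, he⟩, ⟨f, hf⟩⟩ -
    rfl

/-- The maps of the face of the cube on which the coordinate `e` is `1`. -/
def cubeContract (φ : ∀ s t : Finset β, s ⊆ t → X s →ₗ[R] X t) (e : β) (s t : Finset β)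
    (h : s ⊆ t) : X (insert e s) →ₗ[R] X (insert e t) :=
  φ (insert e s) (insert e t) (Finset.insert_subset_insert e h)

/-- The total complex of a cube is the cone of the map between two opposite faces. -/
theorem cubeD_insert (x : ∀ s, X s) {e : β} {s : Finset β} (he : e ∉ s) :
    cubeSign R s e • cubeD φ x (insert e s) =
      φ s (insert e s) (Finset.subset_insert e s) (x s) -
        cubeD (X := fun s => X (insert e s)) (cubeContract φ e)
          (fun s => cubeSign R s e • x (insert e s)) s := by
  have h1 : cubeD φ x (insert e s) = ∑ f ∈ (insert e s).attach,
      cubeSign R (insert e s) f.1 • φ ((insert e s).erase f.1) (insert e s)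
        ((insert e s).erase_subset f.1) (x ((insert e s).erase f.1)) := rfl
  rw [h1, Finset.attach_insert, Finset.sum_insert, smul_add, cubeSign_insert_self,
    cubeSign_smul_smul, sub_eq_add_neg]
  · congr 1
    · exact map_cube_congr x (Finset.erase_insert he) _ _
    · rw [Finset.sum_image, Finset.smul_sum, cubeD, ← Finset.sum_neg_distrib]
      · refine Finset.sum_congr rfl fun f _ => ?_
        have hef : e ≠ f.1 := fun h => he (h ▸ f.2)
        rw [map_smul, smul_smul, smul_smul, cubeSign_mul_insert he f.2, neg_smul]
        congr 2
        exact map_cube_congr x (Finset.erase_insert_of_ne hef) _ _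
      · intro a _ b _ hab
        exact Subtype.ext (Subtype.mk.inj hab)
  · simp only [Finset.mem_image, not_exists, not_and]
    rintro ⟨f, hf⟩ - h
    exact he (Subtype.mk.inj h ▸ hf)

/-- Exactness in the position `i` of the total complex of the cube on the set `E` with entries
`L s / N s`. -/
def CubeExact (φ : ∀ s t : Finset β, s ⊆ t → X s →ₗ[R] X t) (L N : ∀ s, Submodule R (X s))
    (E : Finset β) (i : ℕ) : Prop :=
  ∀ x : ∀ s, X s, (∀ s, x s ∈ L s) → (∀ t ⊆ E, t.card = i + 1 → cubeD φ x t ∈ N t) →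
    ∃ y : ∀ s, X s, (∀ s, y s ∈ L s) ∧ ∀ s ⊆ E, s.card = i → x s - cubeD φ y s ∈ N s

theorem forall_subset_of_erase {E : Finset β} {e : β} {P : Finset β → Prop}
    (h0 : ∀ s ⊆ E.erase e, P s) (h1 : ∀ s ⊆ E.erase e, P (insert e s)) : ∀ s ⊆ E, P s := by
  intro s hs
  by_cases he : e ∈ s
  · rw [← Finset.insert_erase he]
    exact h1 _ (Finset.erase_subset_erase e hs)
  · exact h0 _ (Finset.subset_erase.2 ⟨hs, he⟩)

/-- This is the long exact sequence of the cone, with deletion in position `i` and contraction in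
position `i - 1`. For `i = 0` the contracted face contributes nothing, hence the form of `hcon`. -/
theorem CubeExact.of_faces {L N : ∀ s, Submodule R (X s)} {E : Finset β} {i : ℕ}
    (hid : ∀ s x, φ s s subset_rfl x = x)
    (hφ : ∀ s t u h k x, φ t u k (φ s t h x) = φ s u (h.trans k) x)
    (hL : ∀ s t h, ∀ x ∈ L s, φ s t h x ∈ L t) (hN : ∀ s t h, ∀ x ∈ N s, φ s t h x ∈ N t)
    {e : β} (he : e ∈ E) (hdel : CubeExact φ L N (E.erase e) i)
    (hcon : ∀ k, i = k + 1 → CubeExact (X := fun s => X (insert e s)) (cubeContract φ e)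
      (fun s => L (insert e s)) (fun s => N (insert e s)) (E.erase e) k) :
    CubeExact φ L N E i := by
  intro x hx hdx
  obtain ⟨y, hyL, hy⟩ := hdel x hx fun t ht => hdx t (ht.trans (E.erase_subset e))
  obtain _ | k := i
  -- The only set of size `0` is empty and lies on the deleted face.
  · refine ⟨y, hyL, fun s _ hs => hy s ?_ hs⟩
    rw [Finset.card_eq_zero.1 hs]
    exact Finset.empty_subset _
  have hne : ∀ s ⊆ E.erase e, e ∉ s := fun s hs h => Finset.notMem_erase e E (hs h)
  have hins : ∀ s ⊆ E.erase e, insert e s ⊆ E := fun s hs =>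
    Finset.insert_subset he (hs.trans (E.erase_subset e))
  -- On the deleted face `x - cubeD φ y` already lies in `N` in size `k + 1`, so the cone formula
  -- makes its part on the other face a cocycle modulo `N`.
  obtain ⟨z, hzL, hz⟩ := hcon k rfl (fun s => cubeSign R s e • (x - cubeD φ y) (insert e s))
    (fun s => Submodule.smul_mem _ _ (Submodule.sub_mem _ (hx _) (cubeD_mem hL hyL _))) (by
      intro t ht htc
      have h := cubeD_insert (φ := φ) (x - cubeD φ y) (hne t ht)
      rw [cubeD_sub, cubeD_cubeD hφ, sub_zero, eq_sub_iff_add_eq, ← eq_sub_iff_add_eq'] at h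
      rw [h]
      refine Submodule.sub_mem _ (hN _ _ _ _ (hy t ht htc)) (Submodule.smul_mem _ _ (hdx _ (hins t ht) ?_))
      rw [Finset.card_insert_of_notMem (hne t ht), htc])
  -- The element `z`, placed on the face containing `e`. The map `φ` from `insert e (t.erase e)` to
  -- the equal set `t` acts as a transport, and the minus sign cancels that of the cone.
  let w : ∀ s, X s := fun t => if h : e ∈ t then
    -cubeSign R (t.erase e) e • φ (insert e (t.erase e)) t (Finset.insert_erase h).le
      (z (t.erase e)) else 0
  have hwL : ∀ t, w t ∈ L t := by
    intro t
    dsimp only [w]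
    split_ifs
    · exact Submodule.smul_mem _ _ (hL _ _ _ _ (hzL _))
    · exact Submodule.zero_mem _
  have hw0 : ∀ t, e ∉ t → w t = 0 := fun t ht => dif_neg ht
  have hw1 : ∀ t, e ∉ t → cubeSign R t e • w (insert e t) = - z t := by
    intro t ht
    dsimp only [w]
    rw [dif_pos (Finset.mem_insert_self e t), neg_smul, smul_neg]
    have : ∀ (s : Finset β) (hs : s = t) (hh : insert e s ⊆ insert e t),
        cubeSign R t e • cubeSign R s e • φ (insert e s) (insert e t) hh (z s) = z t := by
      rintro s rfl hh
      rw [cubeSign_smul_smul, hid]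
    rw [this _ (Finset.erase_insert ht)]
  refine ⟨y + w, fun s => Submodule.add_mem _ (hyL s) (hwL s), forall_subset_of_erase
    (e := e) ?_ ?_⟩
  · intro s hs hsc
    rw [cubeD_add, cubeD_eq_zero (x := w) (t := s) fun f _ =>
      hw0 _ fun h => hne s hs (Finset.mem_of_mem_erase h), add_zero]
    exact hy s hs hsc
  · intro s hs hsc
    rw [Finset.card_insert_of_notMem (hne s hs), add_left_inj] at hsc
    have h := cubeD_insert (φ := φ) w (hne s hs)
    rw [hw0 s (hne s hs), map_zero, zero_sub] at h
    rw [cubeD_congr (X := fun s => X (insert e s)) (y := - z) fun f _ =>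
      hw1 _ fun h => hne s hs (Finset.mem_of_mem_erase h)] at h
    have h2 : cubeD (X := fun s => X (insert e s)) (cubeContract φ e) (- z) s =
        - cubeD (X := fun s => X (insert e s)) (cubeContract φ e) z s := by
      rw [← zero_sub, cubeD_sub, cubeD_eq_zero (x := 0) fun _ _ => rfl, zero_sub]
    rw [h2, neg_neg] at h
    rw [cubeD_add, ← cubeSign_smul_mem_iff _ s e, ← sub_sub, smul_sub, h]
    exact hz s hs hsc

/-- If one face of the cube maps onto the opposite face, with a kernel isomorphic to `L' / N'`,
then the complex of the cube is equivalent to that of `L' / N'`. -/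
theorem CubeExact.of_section {L N L' N' : ∀ s, Submodule R (X s)} {E : Finset β} {i : ℕ}
    (hφ : ∀ s t u h k x, φ t u k (φ s t h x) = φ s u (h.trans k) x)
    (hL : ∀ s t h, ∀ x ∈ L s, φ s t h x ∈ L t)
    (hL' : ∀ s, L' s ≤ L s) (hN' : ∀ s, N' s ≤ N s)
    (hN : ∀ s t h, ∀ x ∈ N s, φ s t h x ∈ N t)
    {e : β} (he : e ∈ E)
    (ψ : ∀ s, X (insert e s) →ₗ[R] X s) (ρ : ∀ s, X s →ₗ[R] X s)
    (hψL : ∀ s ⊆ E.erase e, ∀ x ∈ L (insert e s), ψ s x ∈ L s)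
    (hψN : ∀ s ⊆ E.erase e, ∀ x ∈ N (insert e s), ψ s x ∈ N s)
    (hψ : ∀ s ⊆ E.erase e, ∀ x, φ s (insert e s) (Finset.subset_insert e s) (ψ s x) = x)
    (hψφ : ∀ s t h, t ⊆ E.erase e → ∀ x, φ s t h (ψ s x) = ψ t (cubeContract φ e s t h x))
    (hρL : ∀ s ⊆ E.erase e, ∀ x ∈ L s, ρ s x ∈ L' s)
    (hρN : ∀ s ⊆ E.erase e, ∀ x ∈ N s, ρ s x ∈ N' s)
    (hρφ : ∀ s t h, t ⊆ E.erase e → ∀ x ∈ L s, φ s t h (ρ s x) = ρ t (φ s t h x))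
    (hρψ : ∀ s ⊆ E.erase e, ∀ x ∈ L s,
      ψ s (φ s (insert e s) (Finset.subset_insert e s) (x - ρ s x)) = x - ρ s x)
    (hex : CubeExact φ L' N' (E.erase e) i) :
    CubeExact φ L N E i := by
  classical
  intro x hx hdx
  have hne : ∀ s ⊆ E.erase e, e ∉ s := fun s hs h => Finset.notMem_erase e E (hs h)
  have hins : ∀ s ⊆ E.erase e, insert e s ⊆ E := fun s hs =>
    Finset.insert_subset he (hs.trans (E.erase_subset e))
  have hnot : ∀ s, ¬ insert e s ⊆ E.erase e := fun s h => hne _ h (Finset.mem_insert_self e s)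
  have hface : ∀ (w : ∀ s, X s) (s : Finset β), s ⊆ E.erase e →
      (∀ t ⊆ E.erase e, t.card + 1 = s.card → w (insert e t) = 0) →
      cubeSign R s e • cubeD φ w (insert e s) = φ s (insert e s) (Finset.subset_insert e s) (w s) := by
    intro w s hs hw
    rw [cubeD_insert w (hne s hs), cubeD_eq_zero (X := fun s => X (insert e s)), sub_zero]
    intro f hf
    rw [hw _ ((s.erase_subset f).trans hs) (Finset.card_erase_add_one hf), smul_zero]
  -- The section `ψ` lifts the entries of `x` on the face containing `e`, so subtracting `cubeD φ y`
  -- clears that face.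
  let y : ∀ s, X s := fun s => if s ⊆ E.erase e then cubeSign R s e • ψ s (x (insert e s)) else 0
  have hyL : ∀ s, y s ∈ L s := by
    intro s
    dsimp only [y]
    split_ifs with h
    · exact Submodule.smul_mem _ _ (hψL _ h _ (hx _))
    · exact Submodule.zero_mem _
  set x₁ : ∀ s, X s := x - cubeD φ y with hx₁
  have hx₁L : ∀ s, x₁ s ∈ L s := fun s => Submodule.sub_mem _ (hx s) (cubeD_mem hL hyL s)
  have hx₁e : ∀ s ⊆ E.erase e, x₁ (insert e s) = 0 := by
    intro s hs
    have h := hface y s hs fun t _ _ => if_neg (hnot t)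
    dsimp only [y] at h
    rw [if_pos hs, map_smul, hψ s hs] at h
    have h' := congrArg (cubeSign R s e • ·) h
    simp only [cubeSign_smul_smul] at h'
    rw [hx₁, Pi.sub_apply, sub_eq_zero]
    exact h'.symm
  have hdx₁ : ∀ t ⊆ E, t.card = i + 1 → cubeD φ x₁ t ∈ N t := by
    intro t ht htc
    rw [hx₁, cubeD_sub, cubeD_cubeD hφ, sub_zero]
    exact hdx t ht htc
  have hφx₁ : ∀ s ⊆ E.erase e, s.card = i →
      φ s (insert e s) (Finset.subset_insert e s) (x₁ s) ∈ N (insert e s) := by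
    intro s hs hsc
    rw [← hface x₁ s hs fun t ht _ => hx₁e t ht]
    refine Submodule.smul_mem _ _ (hdx₁ _ (hins s hs) ?_)
    rw [Finset.card_insert_of_notMem (hne s hs), hsc]
  -- As `ρ` commutes with the cube maps on `L`, `ρ` of `x₁` is a cocycle modulo `N'` on the deleted
  -- face.
  obtain ⟨z, hzL, hz⟩ := hex (fun s => if s ⊆ E.erase e then ρ s (x₁ s) else 0) (by
    intro s
    split_ifs with h
    · exact hρL s h _ (hx₁L s)
    · exact Submodule.zero_mem _) (by
    intro t ht htc
    have : cubeD φ (fun s => if s ⊆ E.erase e then ρ s (x₁ s) else 0) t = ρ t (cubeD φ x₁ t) := by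
      rw [cubeD, cubeD, map_sum]
      refine Finset.sum_congr rfl fun f _ => ?_
      rw [if_pos ((t.erase_subset f.1).trans ht), map_smul, hρφ _ _ _ ht _ (hx₁L _)]
    rw [this]
    exact hρN t ht _ (hdx₁ t (ht.trans (E.erase_subset e)) htc))
  -- The projection onto the kernel of the map to the opposite face. It brings `z` back into that
  -- kernel, so the correction `w` does not disturb the cleared face.
  let π : ∀ s, X s →ₗ[R] X s := fun s =>
    LinearMap.id - ψ s ∘ₗ φ s (insert e s) (Finset.subset_insert e s)
  have hπ : ∀ s u, π s u = u - ψ s (φ s (insert e s) (Finset.subset_insert e s) u) :=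
    fun _ _ => rfl
  let w : ∀ s, X s := fun s => if s ⊆ E.erase e then π s (z s) else 0
  have hwL : ∀ s, w s ∈ L s := by
    intro s
    dsimp only [w]
    split_ifs with h
    · exact Submodule.sub_mem _ (hL' _ (hzL s)) (hψL _ h _ (hL _ _ _ _ (hL' _ (hzL s))))
    · exact Submodule.zero_mem _
  refine ⟨y + w, fun s => Submodule.add_mem _ (hyL s) (hwL s), forall_subset_of_erase
    (e := e) ?_ ?_⟩
  · intro s hs hsc
    have hdw : cubeD φ w s = π s (cubeD φ z s) := by
      rw [cubeD, cubeD, map_sum]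
      refine Finset.sum_congr rfl fun f _ => ?_
      dsimp only [w]
      rw [if_pos ((s.erase_subset f.1).trans hs), map_smul, hπ, hπ, map_sub, hψφ _ _ _ hs]
      rw [cubeContract, hφ, hφ]
    have h1 : x s - cubeD φ (y + w) s = π s (ρ s (x₁ s) - cubeD φ z s) +
        ψ s (φ s (insert e s) (Finset.subset_insert e s) (x₁ s)) := by
      -- `π ∘ ρ = π` on `L`, since `hρψ` puts `x₁ s - ρ s (x₁ s)` in the kernel of `π s`. This
      -- exhibits the kernel complex as a retract of the one for `L'`.
      have h2 : π s (ρ s (x₁ s)) = π s (x₁ s) := by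
        have h3 : π s (x₁ s - ρ s (x₁ s)) = 0 := by rw [hπ, hρψ s hs _ (hx₁L s), sub_self]
        rw [map_sub, sub_eq_zero] at h3
        exact h3.symm
      rw [map_sub, h2, cubeD_add, ← sub_sub, hdw, hπ s (x₁ s)]
      change x₁ s - _ = _
      abel
    rw [h1]
    have h4 := hz s hs hsc
    rw [if_pos hs] at h4
    have h5 := hN' _ h4
    exact Submodule.add_mem _ (Submodule.sub_mem _ h5 (hψN _ hs _ (hN _ _ _ _ h5)))
      (hψN _ hs _ (hφx₁ s hs hsc))
  · intro s hs _
    have h := hface w s hs fun t _ _ => if_neg (hnot t)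
    have h0 : φ s (insert e s) (Finset.subset_insert e s) (w s) = 0 := by
      dsimp only [w]
      rw [if_pos hs, hπ, map_sub, hψ s hs, sub_self]
    rw [h0] at h
    have h' := congrArg (cubeSign R s e • ·) h
    simp only [cubeSign_smul_smul, smul_zero] at h'
    rw [cubeD_add, h', add_zero]
    change x₁ (insert e s) ∈ _
    rw [hx₁e s hs]
    exact Submodule.zero_mem _

end Cube

/-! ### Partitions indexed by sets of edges -/

/-- A partition of `V` for each set of edges, which becomes coarser when the set of edges grows. The
set of blocks is `block s`. -/
structure PartitionCube (V β : Type*) where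
  block : Finset β → Type*
  part : ∀ s, V → block s
  part_surjective : ∀ s, Function.Surjective (part s)
  map : ∀ s t, s ⊆ t → block s → block t
  map_part : ∀ s t h v, map s t h (part s v) = part t v

namespace PartitionCube

variable {V β : Type*} (C : PartitionCube V β)

instance [Finite V] (s : Finset β) : Finite (C.block s) :=
  Finite.of_surjective _ (C.part_surjective s)

theorem part_eq_mono {s t : Finset β} (h : s ⊆ t) {a b : V} (hab : C.part s a = C.part s b) :
    C.part t a = C.part t b := by
  rw [← C.map_part s t h, hab, C.map_part]

theorem map_map {s t u : Finset β} (h : s ⊆ t) (k : t ⊆ u) (c : C.block s) :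
    C.map t u k (C.map s t h c) = C.map s u (h.trans k) c := by
  obtain ⟨v, rfl⟩ := C.part_surjective s c
  simp only [map_part]

theorem map_id (s : Finset β) (c : C.block s) : C.map s s subset_rfl c = c := by
  obtain ⟨v, rfl⟩ := C.part_surjective s c
  rw [map_part]

/-- The blocks that do not meet `W`. -/
def free (W : Set V) (s : Finset β) : Set (C.block s) :=
  {c | ∀ w ∈ W, C.part s w ≠ c}

/-! ### Effect of one edge on the blocks, and counting of free blocks. -/

variable [DecidableEq β]

/-- Adding `e` to the set of edges joins the blocks of `x` and `y`. -/
def Joins (e : β) (x y : V) : Prop :=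
  ∀ s a b, C.part (insert e s) a = C.part (insert e s) b ↔ C.part s a = C.part s b ∨
    (C.part s a = C.part s x ∧ C.part s b = C.part s y) ∨ (C.part s a = C.part s y ∧ C.part s b = C.part s x)

/-- The partitions for the sets of edges that contain `e`. -/
abbrev contract (e : β) : PartitionCube V β where
  block s := C.block (insert e s)
  part s := C.part (insert e s)
  part_surjective _ := C.part_surjective _
  map _ _ h := C.map _ _ (Finset.insert_subset_insert e h)
  map_part _ _ _ _ := C.map_part _ _ _ _

variable {C}

theorem Joins.symm {e : β} {x y : V} (h : C.Joins e x y) : C.Joins e y x := fun s a b => by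
  rw [h s a b, or_comm (a := _ ∧ _)]

theorem Joins.contract {e f : β} {x y : V} (h : C.Joins f x y) : (C.contract e).Joins f x y := by
  intro s a b
  have := h (insert e s) a b
  rwa [Finset.insert_comm] at this

theorem Joins.part_eq {e : β} {x y : V} (h : C.Joins e x y) (s : Finset β) :
    C.part (insert e s) x = C.part (insert e s) y :=
  (h s x y).2 (Or.inr (Or.inl ⟨rfl, rfl⟩))

/-- Only the blocks of `x` and `y` are merged, so nothing is identified once one of the two is
discarded. -/
theorem Joins.eq_of_map_eq {e : β} {x y : V} (h : C.Joins e x y) {s : Finset β}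
    {c d : C.block s} (hc : c ≠ C.part s x) (hd : d ≠ C.part s x)
    (hcd : C.map s (insert e s) (Finset.subset_insert e s) c =
      C.map s (insert e s) (Finset.subset_insert e s) d) : c = d := by
  obtain ⟨a, rfl⟩ := C.part_surjective s c
  obtain ⟨b, rfl⟩ := C.part_surjective s d
  rw [C.map_part, C.map_part, h s a b] at hcd
  tauto

variable [Finite V]

theorem Joins.card_le {e : β} {x y : V} (h : C.Joins e x y) (s : Finset β) :
    Nat.card (C.block s) ≤ Nat.card (C.block (insert e s)) + 1 := by
  have h1 : ({C.part s x}ᶜ : Set (C.block s)).ncard ≤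
      (Set.univ : Set (C.block (insert e s))).ncard :=
    Set.ncard_le_ncard_of_injOn (C.map s (insert e s) (Finset.subset_insert e s))
      (fun _ _ => Set.mem_univ _) (fun c hc d hd => h.eq_of_map_eq hc hd)
  rw [Set.ncard_univ] at h1
  have h2 := Set.ncard_add_ncard_compl ({C.part s x} : Set (C.block s))
  rw [Set.ncard_singleton] at h2
  omega

/-- This pays for cutting a leaf: marking `x` removes its block from the free ones, and the merged
block stays free if that of `y` was, because the block of `x` missed `W`. -/
theorem Joins.ncard_free_le_of_free {e : β} {x y : V} (h : C.Joins e x y) {s : Finset β}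
    {W : Set V} (hx : C.part s x ∈ C.free W s) :
    (C.free (insert x W) s).ncard ≤ (C.free W (insert e s)).ncard := by
  refine Set.ncard_le_ncard_of_injOn (C.map s (insert e s) (Finset.subset_insert e s)) ?_
    fun c hc d hd => h.eq_of_map_eq (hc x (Set.mem_insert _ _)).symm
      (hd x (Set.mem_insert _ _)).symm
  intro c hc w hw hwc
  obtain ⟨v, rfl⟩ := C.part_surjective s c
  rw [C.map_part, h s w v] at hwc
  have h1 := hc x (Set.mem_insert _ _)
  have h2 := hc w (Set.mem_insert_of_mem _ hw)
  have h3 := hx w hw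
  tauto

/-- The hypothesis says that any merging takes place between blocks that are not free, so the free
blocks are carried injectively to free blocks. This is used for deletion of `e`. -/
theorem Joins.ncard_free_le {e : β} {x y : V} (h : C.Joins e x y) {s : Finset β} {W : Set V}
    (hxy : C.part s x ≠ C.part s y → C.part s x ∉ C.free W s ∧ C.part s y ∉ C.free W s) :
    (C.free W s).ncard ≤ (C.free W (insert e s)).ncard := by
  refine Set.ncard_le_ncard_of_injOn (C.map s (insert e s) (Finset.subset_insert e s)) ?_ ?_
  · intro c hc w hw hwc
    obtain ⟨v, rfl⟩ := C.part_surjective s c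
    rw [C.map_part, h s w v] at hwc
    have h2 := hc w hw
    by_cases hx : C.part s x = C.part s y
    · rw [hx] at hwc
      exact h2 (by aesop)
    · obtain h3 | h3 | h3 := hwc
      · exact h2 h3
      · exact (hxy hx).2 (h3.2 ▸ hc)
      · exact (hxy hx).1 (h3.2 ▸ hc)
  · intro c hc d hd hcd
    obtain ⟨a, rfl⟩ := C.part_surjective s c
    obtain ⟨b, rfl⟩ := C.part_surjective s d
    rw [C.map_part, C.map_part, h s a b] at hcd
    by_cases hx : C.part s x = C.part s y
    · rw [hx] at hcd
      aesop
    · obtain h3 | h3 | h3 := hcd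
      · exact h3
      · exact absurd (h3.1 ▸ hc) (hxy hx).1
      · exact absurd (h3.1 ▸ hc) (hxy hx).2

/-- If all edges in `E` are bridges and one of them bounds a part that does not meet `W`, then this
part contains a leaf. -/
theorem exists_leaf {E : Finset β} {W : Set V} (hE : ∀ e ∈ E, ∃ x y, C.Joins e x y)
    (hbridge : ∀ e ∈ E, ∀ x y, C.Joins e x y → C.part (E.erase e) x ≠ C.part (E.erase e) y) (n : ℕ) :
    ∀ e ∈ E, ∀ x y, C.Joins e x y → C.part (E.erase e) x ∈ C.free W (E.erase e) →
      {v | C.part (E.erase e) x = C.part (E.erase e) v}.ncard = n →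
      ∃ e ∈ E, ∃ x y, C.Joins e x y ∧ C.part (E.erase e) x ∈ C.free W (E.erase e) ∧
        ∀ v, C.part (E.erase e) x = C.part (E.erase e) v → C.part ∅ x = C.part ∅ v := by
  induction n using Nat.strong_induction_on with
  | _ n ih =>
  intro e he x y hxy hx hn
  by_cases hleaf : ∀ v, C.part (E.erase e) x = C.part (E.erase e) v → C.part ∅ x = C.part ∅ v
  · exact ⟨e, he, x, y, hxy, hx, hleaf⟩
  -- Some other edge leaves the block of `x` itself: otherwise that block never grows as edges of
  -- `E.erase e` are added, and it would be a leaf.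
  obtain ⟨f, hf, b, hJ⟩ : ∃ f ∈ E.erase e, ∃ b, C.Joins f x b := by
    by_contra hcon
    push Not at hcon
    have hno : ∀ f ∈ E.erase e, ∀ a b, C.Joins f a b → C.part ∅ x ≠ C.part ∅ a := by
      intro f hf a b hab h
      refine hcon f hf b fun s c d => ?_
      rw [C.part_eq_mono (Finset.empty_subset s) h]
      exact hab s c d
    refine hleaf ?_
    suffices h : ∀ s ⊆ E.erase e, ∀ v, C.part s x = C.part s v → C.part ∅ x = C.part ∅ v from
      h _ subset_rfl
    intro s
    induction s using Finset.induction_on with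
    | empty => exact fun _ _ h => h
    | insert f s _ ihs =>
      intro hs v hv
      have hf := hs (Finset.mem_insert_self f s)
      have hs' := (Finset.subset_insert f s).trans hs
      obtain ⟨a, b, hab⟩ := hE f (Finset.mem_of_mem_erase hf)
      obtain h | h | h := (hab s x v).1 hv
      · exact ihs hs' v h
      · exact absurd (ihs hs' a h.1) (hno f hf a b hab)
      · exact absurd (ihs hs' b h.1) (hno f hf b a hab.symm)
  have hfE := Finset.mem_of_mem_erase hf
  have hfe : f ≠ e := Finset.ne_of_mem_erase hf
  have hbr := hbridge f hfE x b hJ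
  set S := (E.erase e).erase f with hS
  have hS1 : E.erase e = insert f S := (Finset.insert_erase hf).symm
  have hS2 : E.erase f = insert e S := by
    rw [hS, Finset.erase_right_comm, Finset.insert_erase (Finset.mem_erase.2 ⟨hfe.symm, he⟩)]
  have hxb : C.part (E.erase e) x = C.part (E.erase e) b := by
    rw [hS1]
    exact hJ.part_eq S
  -- The far side of `f` cannot reach `e`, or `f` would not be a bridge. It therefore lies inside
  -- the side of `e` containing `x`.
  have hsub : ∀ v, C.part (E.erase f) b = C.part (E.erase f) v →
      C.part (E.erase e) x = C.part (E.erase e) v := by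
    intro v hv
    rw [hxb, hS1]
    rw [hS2] at hv hbr
    obtain h | h | h := (hxy S b v).1 hv
    · exact C.part_eq_mono (Finset.subset_insert f S) h
    · exact absurd (C.part_eq_mono (Finset.subset_insert e S) h.1).symm hbr
    · exact absurd (((hxy S x b).2 (Or.inr (Or.inl ⟨rfl, h.1⟩)))) hbr
  refine ih _ ?_ f hfE b x hJ.symm (fun w hw hwb => hx w hw (hsub w hwb.symm).symm) rfl
  rw [← hn]
  -- The inclusion is strict because `x` is not on the far side of the bridge `f`.
  exact Set.ncard_lt_ncard ⟨hsub, fun h => hbr (h (rfl : C.part (E.erase e) x = _)).symm⟩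
    (Set.toFinite _)

end PartitionCube

/-! ### Homogeneous tensors with prescribed entries of positive degree -/

section Tensor

variable {R A ι κ : Type*} [CommRing R] [CommRing A] [Algebra R A]

/-- The span of the homogeneous pure tensors of degree `j` whose entries at the places in `U` have
positive degree. -/
def tensorDegreePos (𝒜 : ℕ → Submodule R A) (U : Set ι) (j : ℕ) : Submodule R (⨂[R] _ : ι, A) :=
  Submodule.span R {x | ∃ (a : ι → A) (deg : ι → ℕ), (∀ i, a i ∈ 𝒜 (deg i)) ∧
    ∑ᶠ i, deg i = j ∧ (∀ i ∈ U, 1 ≤ deg i) ∧ x = PiTensorProduct.tprod R a}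

theorem tensorDegreePos_empty [Finite ι] (𝒜 : ℕ → Submodule R A) (j : ℕ) :
    tensorDegreePos 𝒜 (∅ : Set ι) j = tensorDegree 𝒜 ι j := by
  simp [tensorDegreePos, tensorDegree]

theorem tensorDegreePos_anti (𝒜 : ℕ → Submodule R A) {U U' : Set ι} (h : U ⊆ U') (j : ℕ) :
    tensorDegreePos 𝒜 U' j ≤ tensorDegreePos 𝒜 U j := by
  refine Submodule.span_mono ?_
  rintro _ ⟨a, deg, ha, hj, hU, rfl⟩
  exact ⟨a, deg, ha, hj, fun i hi => hU i (h hi), rfl⟩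

theorem tensorDegreePos_eq_bot [Finite ι] (𝒜 : ℕ → Submodule R A) {U : Set ι} {j : ℕ}
    (h : j < U.ncard) : tensorDegreePos 𝒜 U j = ⊥ := by
  classical
  cases nonempty_fintype ι
  rw [tensorDegreePos, Submodule.span_eq_bot]
  rintro _ ⟨a, deg, ha, hj, hU, rfl⟩
  rw [finsum_eq_sum_of_fintype] at hj
  rw [Set.ncard_eq_toFinset_card', Finset.card_eq_sum_ones] at h
  have h1 : ∑ i ∈ U.toFinset, 1 ≤ ∑ i ∈ U.toFinset, deg i :=
    Finset.sum_le_sum fun i hi => hU i (Set.mem_toFinset.1 hi)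
  have h2 : ∑ i ∈ U.toFinset, deg i ≤ ∑ i, deg i :=
    Finset.sum_le_sum_of_subset (Finset.subset_univ _)
  omega

/-- Degrees add up over a fibre, so one factor of positive degree is enough. -/
theorem mergeMul_mem_tensorDegreePos (𝒜 : ℕ → Submodule R A) [SetLike.GradedMonoid 𝒜]
    [Finite ι] [Finite κ] {U : Set ι} {U' : Set κ} (f : ι → κ) (hf : ∀ k ∈ U', ∃ i ∈ U, f i = k)
    {j : ℕ} {x : ⨂[R] _ : ι, A} (hx : x ∈ tensorDegreePos 𝒜 U j) :
    mergeMul R A f x ∈ tensorDegreePos 𝒜 U' j := by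
  classical
  cases nonempty_fintype ι
  cases nonempty_fintype κ
  refine (Submodule.span_le (p := (tensorDegreePos 𝒜 U' j).comap (mergeMul R A f))).2 ?_ hx
  rintro _ ⟨a, deg, ha, hj, hU, rfl⟩
  refine Submodule.subset_span ⟨_, fun k => ∑ i with f i = k, deg i, fun k => ?_, ?_, ?_,
    mergeMul_tprod f a⟩
  · exact SetLike.prod_mem_graded _ _ _ fun i _ => ha i
  · rw [finsum_eq_sum_of_fintype] at hj ⊢
    rw [← hj]
    exact Finset.sum_fiberwise _ _ _
  · intro k hk
    obtain ⟨i, hi, rfl⟩ := hf k hk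
    exact (hU i hi).trans (Finset.single_le_sum (f := deg) (fun _ _ => Nat.zero_le _) (by simp))

theorem mergeMul_id [Finite ι] (x : ⨂[R] _ : ι, A) : mergeMul R A (id : ι → ι) x = x := by
  classical
  cases nonempty_fintype ι
  suffices h : mergeMul R A (id : ι → ι) = LinearMap.id from LinearMap.congr_fun h x
  ext a
  simp only [LinearMap.compMultilinearMap_apply, mergeMul_tprod, LinearMap.id_apply]
  congr 1
  funext k
  exact (Finset.prod_filter _ _).trans (by simp)

/-- Moving a scalar entry to another place does not change a pure tensor. -/
theorem mergeMul_tprod_of_mem_span_one [Finite ι] {f : ι → ι} {c : ι} (hf : ∀ i ≠ c, f i = i)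
    (hc : f c ≠ c) {a : ι → A} (ha : a c ∈ Submodule.span R {(1 : A)}) :
    mergeMul R A f (PiTensorProduct.tprod R a) = PiTensorProduct.tprod R a := by
  classical
  cases nonempty_fintype ι
  obtain ⟨r, hr⟩ := Submodule.mem_span_singleton.1 ha
  have h : PiTensorProduct.tprod R a = r • PiTensorProduct.tprod R (Function.update a c 1) := by
    rw [← MultilinearMap.map_update_smul, hr, Function.update_eq_self]
  rw [h, map_smul, mergeMul_tprod]
  congr 2
  funext k
  by_cases hk : k = c
  · subst hk
    rw [Function.update_self]
    refine Finset.prod_eq_one fun i hi => ?_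
    have hi := (Finset.mem_filter.1 hi).2
    by_cases hik : i = k
    · exact absurd (hik ▸ hi) (hik ▸ hc)
    · exact absurd ((hf i hik).symm.trans hi) hik
  · refine Finset.prod_eq_single k (fun i hi hik => ?_) fun h => ?_
    · have hi := (Finset.mem_filter.1 hi).2
      by_cases hic : i = c
      · rw [hic, Function.update_self]
      · exact absurd ((hf i hic).symm.trans hi) hik
    · exact absurd (Finset.mem_filter.2 ⟨Finset.mem_univ k, hf k hk⟩ : k ∈ Finset.univ.filter (f · = k)) h

open Classical in
/-- The projection to the tensors whose entry at the place `c` has no component of degree `0`. -/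
def posPart (𝒜 : ℕ → Submodule R A) [GradedAlgebra 𝒜] (c : ι) :
    (⨂[R] _ : ι, A) →ₗ[R] (⨂[R] _ : ι, A) :=
  PiTensorProduct.map
    (Function.update (fun _ => LinearMap.id) c (LinearMap.id - GradedAlgebra.proj 𝒜 0))

theorem posPart_tprod_of_pos (𝒜 : ℕ → Submodule R A) [GradedAlgebra 𝒜] {c : ι} {a : ι → A} {d : ℕ}
    (ha : a c ∈ 𝒜 d) (hd : 1 ≤ d) :
    posPart 𝒜 c (PiTensorProduct.tprod R a) = PiTensorProduct.tprod R a := by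
  classical
  rw [posPart, PiTensorProduct.map_tprod]
  congr 1
  funext k
  by_cases hk : k = c
  · subst hk
    rw [Function.update_self, LinearMap.sub_apply, LinearMap.id_apply, GradedAlgebra.proj_apply,
      DirectSum.decompose_of_mem_ne 𝒜 ha (by omega), sub_zero]
  · rw [Function.update_of_ne hk, LinearMap.id_apply]

theorem posPart_tprod_of_zero (𝒜 : ℕ → Submodule R A) [GradedAlgebra 𝒜] {c : ι} {a : ι → A}
    (ha : a c ∈ 𝒜 0) : posPart 𝒜 c (PiTensorProduct.tprod R a) = 0 := by
  classical
  rw [posPart, PiTensorProduct.map_tprod]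
  refine MultilinearMap.map_coord_zero _ c ?_
  rw [Function.update_self, LinearMap.sub_apply, LinearMap.id_apply, GradedAlgebra.proj_apply,
    DirectSum.decompose_of_mem_same 𝒜 ha, sub_self]

theorem posPart_mem_tensorDegreePos (𝒜 : ℕ → Submodule R A) [GradedAlgebra 𝒜] {U : Set ι} {j : ℕ}
    (c : ι) {x : ⨂[R] _ : ι, A} (hx : x ∈ tensorDegreePos 𝒜 U j) :
    posPart 𝒜 c x ∈ tensorDegreePos 𝒜 (insert c U) j := by
  refine (Submodule.span_le (p := (tensorDegreePos 𝒜 (insert c U) j).comap (posPart 𝒜 c))).2 ?_ hx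
  rintro _ ⟨a, deg, ha, hj, hU, rfl⟩
  rw [Submodule.comap_coe, Set.mem_preimage, SetLike.mem_coe]
  obtain h0 | hpos := Nat.eq_zero_or_pos (deg c)
  · rw [posPart_tprod_of_zero 𝒜 (h0 ▸ ha c)]
    exact Submodule.zero_mem _
  · rw [posPart_tprod_of_pos 𝒜 (ha c) hpos]
    refine Submodule.subset_span ⟨a, deg, ha, hj, ?_, rfl⟩
    rintro i (rfl | hi)
    · exact hpos
    · exact hU i hi

/-- The place `c` is alone in its fibre, so its entry is moved without being multiplied by anything.
-/
theorem mergeMul_posPart (𝒜 : ℕ → Submodule R A) [GradedAlgebra 𝒜] [Finite ι] {f : ι → κ} {c : ι}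
    (hf : ∀ i, f i = f c → i = c) {U : Set ι} {j : ℕ} {x : ⨂[R] _ : ι, A}
    (hx : x ∈ tensorDegreePos 𝒜 U j) :
    mergeMul R A f (posPart 𝒜 c x) = posPart 𝒜 (f c) (mergeMul R A f x) := by
  classical
  cases nonempty_fintype ι
  refine LinearMap.eqOn_span (f := mergeMul R A f ∘ₗ posPart 𝒜 c)
    (g := posPart 𝒜 (f c) ∘ₗ mergeMul R A f) ?_ hx
  rintro _ ⟨a, deg, ha, hj, hU, rfl⟩
  rw [LinearMap.comp_apply, LinearMap.comp_apply]
  have hfc : ∏ i with f i = f c, a i = a c := by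
    refine Finset.prod_eq_single c (fun i hi hic => ?_) fun h => ?_
    · exact absurd (hf i (Finset.mem_filter.1 hi).2) hic
    · exact absurd (Finset.mem_filter.2 ⟨Finset.mem_univ c, rfl⟩ : c ∈ Finset.univ.filter (f · = f c)) h
  obtain h0 | hpos := Nat.eq_zero_or_pos (deg c)
  · rw [posPart_tprod_of_zero 𝒜 (h0 ▸ ha c), map_zero, mergeMul_tprod, posPart_tprod_of_zero]
    rw [hfc]
    exact h0 ▸ ha c
  · rw [posPart_tprod_of_pos 𝒜 (ha c) hpos, mergeMul_tprod, posPart_tprod_of_pos 𝒜 _ hpos]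
    rw [hfc]
    exact ha c

/-- The difference retains only the pure tensors whose entry at `c` has degree zero. Such an entry
is a scalar by `h𝒜`, and `f` merely moves it to another place. -/
theorem mergeMul_sub_posPart (𝒜 : ℕ → Submodule R A) [GradedAlgebra 𝒜] [Finite ι]
    (h𝒜 : 𝒜 0 ≤ Submodule.span R {1}) {f : ι → ι} {c : ι} (hf : ∀ i ≠ c, f i = i)
    (hc : f c ≠ c) {U : Set ι} {j : ℕ} {x : ⨂[R] _ : ι, A} (hx : x ∈ tensorDegreePos 𝒜 U j) :
    mergeMul R A f (x - posPart 𝒜 c x) = x - posPart 𝒜 c x := by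
  refine LinearMap.eqOn_span (f := mergeMul R A f ∘ₗ (LinearMap.id - posPart 𝒜 c))
    (g := LinearMap.id - posPart 𝒜 c) ?_ hx
  rintro _ ⟨a, deg, ha, hj, hU, rfl⟩
  rw [LinearMap.comp_apply, LinearMap.sub_apply, LinearMap.id_apply]
  obtain h0 | hpos := Nat.eq_zero_or_pos (deg c)
  · rw [posPart_tprod_of_zero 𝒜 (h0 ▸ ha c), sub_zero,
      mergeMul_tprod_of_mem_span_one hf hc (h𝒜 (h0 ▸ ha c))]
  · rw [posPart_tprod_of_pos 𝒜 (ha c) hpos, sub_self, map_zero]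

end Tensor

/-! ### The vanishing theorem -/

namespace PartitionCube

variable {V β : Type*} (C : PartitionCube V β) (R : Type*) {A : Type*}
  [CommRing R] [CommRing A] [Algebra R A]

variable {R}

/-- The tensors of degree `j` whose entries at the blocks that meet `W` have positive degree. -/
def graded (𝒜 : ℕ → Submodule R A) (W : Set V) (j : ℕ) (s : Finset β) :
    Submodule R (⨂[R] _ : C.block s, A) :=
  tensorDegreePos 𝒜 (C.part s '' W) j

/-- The multiples of `n` in `graded`. -/
def gradedSMul (𝒜 : ℕ → Submodule R A) (n : R) (W : Set V) (j : ℕ) (s : Finset β) :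
    Submodule R (⨂[R] _ : C.block s, A) :=
  (C.graded 𝒜 W j s).map (LinearMap.lsmul R _ n)

variable {C} in
theorem map_mem_gradedSMul {C' : PartitionCube V β} {𝒜 : ℕ → Submodule R A} {n : R} {W W' : Set V}
    {j : ℕ} {s t : Finset β} {f : (⨂[R] _ : C.block s, A) →ₗ[R] (⨂[R] _ : C'.block t, A)}
    (hf : ∀ x ∈ C.graded 𝒜 W j s, f x ∈ C'.graded 𝒜 W' j t) :
    ∀ x ∈ C.gradedSMul 𝒜 n W j s, f x ∈ C'.gradedSMul 𝒜 n W' j t := by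
  rintro _ ⟨x, hx, rfl⟩
  exact ⟨f x, hf x hx, (map_smul f n x).symm⟩

section Retract

variable [DecidableEq β]

open Classical in
/-- For an edge `e` that joins the blocks of `x` and `y`, the section of the map of blocks whose
range avoids the block of `x` if it can. -/
def retract (e : β) (x y : V) (s : Finset β) (c : C.block (insert e s)) : C.block s :=
  if C.part s (Function.surjInv (C.part_surjective _) c) = C.part s x then C.part s y
  else C.part s (Function.surjInv (C.part_surjective _) c)

variable {C}

-- The chosen representative is determined up to exchanging the blocks of `x` and `y`. Both of these
-- go to the block of `y`, so the choice is immaterial.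
open Classical in
theorem Joins.retract_part {e : β} {x y : V} (h : C.Joins e x y) (s : Finset β) (v : V) :
    C.retract e x y s (C.part (insert e s) v) =
      if C.part s v = C.part s x then C.part s y else C.part s v := by
  rw [retract]
  have hu := Function.surjInv_eq (C.part_surjective (insert e s)) (C.part (insert e s) v)
  set u := Function.surjInv (C.part_surjective (insert e s)) (C.part (insert e s) v)
  rw [h s u v] at hu
  obtain hu | ⟨hu, hv⟩ | ⟨hu, hv⟩ := hu
  · rw [hu]
  · rw [hu, hv, if_pos rfl]
    split_ifs <;> simp_all
  · rw [hu, hv, if_pos rfl]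
    split_ifs <;> simp_all

theorem Joins.map_retract {e : β} {x y : V} (h : C.Joins e x y) (s : Finset β)
    (c : C.block (insert e s)) :
    C.map s (insert e s) (Finset.subset_insert e s) (C.retract e x y s c) = c := by
  classical
  obtain ⟨v, rfl⟩ := C.part_surjective _ c
  rw [h.retract_part]
  split_ifs with hv
  · rw [C.map_part, ← h.part_eq s, C.part_eq_mono (Finset.subset_insert e s) hv]
  · rw [C.map_part]

end Retract

variable [Finite V]

theorem ncard_image_add_ncard_free (W : Set V) (s : Finset β) :
    (C.part s '' W).ncard + (C.free W s).ncard = Nat.card (C.block s) := by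
  have h : C.free W s = (C.part s '' W)ᶜ := by
    ext c
    simp [free]
  rw [h, Set.ncard_add_ncard_compl]

/-- The map of tensor powers induced by coarsening a partition. -/
def tensorMap (R A : Type*) [CommRing R] [CommRing A] [Algebra R A] (s t : Finset β) (h : s ⊆ t) :
    (⨂[R] _ : C.block s, A) →ₗ[R] (⨂[R] _ : C.block t, A) :=
  mergeMul R A (C.map s t h)

variable {C}

theorem tensorMap_id (s : Finset β) (x : ⨂[R] _ : C.block s, A) :
    C.tensorMap R A s s subset_rfl x = x := by
  have h : C.map s s subset_rfl = id := funext (C.map_id s)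
  rw [tensorMap, h, mergeMul_id]

theorem tensorMap_tensorMap (s t u : Finset β) (h : s ⊆ t) (k : t ⊆ u)
    (x : ⨂[R] _ : C.block s, A) :
    C.tensorMap R A t u k (C.tensorMap R A s t h x) = C.tensorMap R A s u (h.trans k) x := by
  rw [tensorMap, tensorMap, mergeMul_mergeMul, tensorMap]
  congr 2
  exact funext (C.map_map h k)

theorem tensorMap_mem_graded (𝒜 : ℕ → Submodule R A) [SetLike.GradedMonoid 𝒜] {W : Set V} {j : ℕ}
    (s t : Finset β) (h : s ⊆ t) :
    ∀ x ∈ C.graded 𝒜 W j s, C.tensorMap R A s t h x ∈ C.graded 𝒜 W j t := by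
  refine fun x hx => mergeMul_mem_tensorDegreePos 𝒜 _ ?_ hx
  rintro _ ⟨w, hw, rfl⟩
  exact ⟨_, ⟨w, hw, rfl⟩, C.map_part s t h w⟩

variable [LinearOrder β]

/-- The map of tensor powers induced by `retract`. -/
def tensorRetract (C : PartitionCube V β) (R A : Type*) [CommRing R] [CommRing A] [Algebra R A]
    (e : β) (x y : V) (s : Finset β) :
    (⨂[R] _ : C.block (insert e s), A) →ₗ[R] (⨂[R] _ : C.block s, A) :=
  mergeMul R A (C.retract e x y s)

theorem Joins.tensorMap_tensorRetract {e : β} {x y : V} (h : C.Joins e x y) (s : Finset β)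
    (z : ⨂[R] _ : C.block (insert e s), A) :
    C.tensorMap R A s (insert e s) (Finset.subset_insert e s) (C.tensorRetract R A e x y s z) =
      z := by
  have hid : C.map s (insert e s) (Finset.subset_insert e s) ∘ C.retract e x y s = id :=
    funext (h.map_retract s)
  rw [tensorMap, tensorRetract, mergeMul_mergeMul, hid, mergeMul_id]

theorem tensorRetract_mem_graded (𝒜 : ℕ → Submodule R A) [SetLike.GradedMonoid 𝒜] {W : Set V}
    {j : ℕ} {e : β} {x y : V} {s : Finset β}
    (hW : ∀ w ∈ W, C.retract e x y s (C.part (insert e s) w) = C.part s w) :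
    ∀ z ∈ C.graded 𝒜 W j (insert e s), C.tensorRetract R A e x y s z ∈ C.graded 𝒜 W j s := by
  refine fun z hz => mergeMul_mem_tensorDegreePos 𝒜 _ ?_ hz
  rintro _ ⟨w, hw, rfl⟩
  exact ⟨_, ⟨w, hw, rfl⟩, hW w hw⟩

theorem tensorMap_tensorRetract_comm {e : β} {x y : V} {s t : Finset β} (h : s ⊆ t)
    (hst : ∀ v, C.map s t h (C.retract e x y s (C.part (insert e s) v)) =
      C.retract e x y t (C.part (insert e t) v)) (z : ⨂[R] _ : C.block (insert e s), A) :
    C.tensorMap R A s t h (C.tensorRetract R A e x y s z) =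
      C.tensorRetract R A e x y t (cubeContract (C.tensorMap R A) e s t h z) := by
  rw [cubeContract, tensorMap, tensorRetract, tensorRetract, tensorMap, mergeMul_mergeMul,
    mergeMul_mergeMul]
  congr 2
  funext c
  obtain ⟨v, rfl⟩ := C.part_surjective _ c
  rw [Function.comp_apply, Function.comp_apply, C.map_part]
  exact hst v

/-! ### The loop and leaf reductions, and the induction on edges. -/

theorem cubeExact_bot {X : Finset β → Type*} [∀ s, AddCommGroup (X s)] [∀ s, Module R (X s)]
    (φ : ∀ s t : Finset β, s ⊆ t → X s →ₗ[R] X t) (E : Finset β) (i : ℕ) :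
    CubeExact φ (fun _ => ⊥) (fun _ => ⊥) E i := by
  refine fun x hx _ => ⟨0, fun _ => Submodule.zero_mem _, fun s _ _ => ?_⟩
  rw [(Submodule.mem_bot R).1 (hx s), cubeD_eq_zero (x := 0) fun _ _ => rfl, sub_zero]
  exact Submodule.zero_mem _

/-- An edge that joins a block to itself makes the complex exact. -/
theorem Joins.cubeExact_of_part_eq {𝒜 : ℕ → Submodule R A} [GradedAlgebra 𝒜] {n : R} {E : Finset β}
    {W : Set V} {i j : ℕ} {e : β} (he : e ∈ E) {x y : V} (h : C.Joins e x y)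
    (hxy : C.part ∅ x = C.part ∅ y) :
    CubeExact (C.tensorMap R A) (C.graded 𝒜 W j) (C.gradedSMul 𝒜 n W j) E i := by
  have hret : ∀ s v, C.retract e x y s (C.part (insert e s) v) = C.part s v := by
    classical
    intro s v
    rw [h.retract_part]
    split_ifs with hv
    · rw [hv, C.part_eq_mono (Finset.empty_subset s) hxy]
    · rfl
  refine CubeExact.of_section (L' := fun _ => ⊥) (N' := fun _ => ⊥) tensorMap_tensorMap
    (tensorMap_mem_graded 𝒜) (fun _ => bot_le) (fun _ => bot_le)
    (fun s t h => map_mem_gradedSMul (tensorMap_mem_graded 𝒜 s t h)) he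
    (C.tensorRetract R A e x y) (fun _ => 0)
    (fun s _ => tensorRetract_mem_graded 𝒜 fun w _ => hret s w)
    (fun s _ => map_mem_gradedSMul (C := C.contract e) (tensorRetract_mem_graded 𝒜 fun w _ => hret s w))
    (fun s _ => h.tensorMap_tensorRetract s) (fun s t hst _ => tensorMap_tensorRetract_comm hst
      fun v => by rw [hret, hret, C.map_part])
    (fun _ _ _ _ => Submodule.zero_mem _) (fun _ _ _ _ => Submodule.zero_mem _)
    (fun s t h _ x _ => by simp) (fun s hs z _ => ?_) (cubeExact_bot _ _ _)
  have hid : C.retract e x y s ∘ C.map s (insert e s) (Finset.subset_insert e s) = id := by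
    funext c
    obtain ⟨v, rfl⟩ := C.part_surjective _ c
    rw [Function.comp_apply, C.map_part, hret, id_eq]
  rw [tensorMap, tensorRetract, mergeMul_mergeMul, hid, mergeMul_id]

/-- A leaf can be cut off, at the cost of allowing only entries of positive degree at the leaf. -/
theorem Joins.cubeExact_of_leaf {𝒜 : ℕ → Submodule R A} [GradedAlgebra 𝒜]
    (h𝒜 : 𝒜 0 ≤ Submodule.span R {1}) {n : R} {E : Finset β}
    {W : Set V} {i j : ℕ} {e : β} (he : e ∈ E) {x y : V} (h : C.Joins e x y)
    (hxy : C.part (E.erase e) x ≠ C.part (E.erase e) y)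
    (hx : C.part (E.erase e) x ∈ C.free W (E.erase e))
    (hleaf : ∀ v, C.part (E.erase e) x = C.part (E.erase e) v → C.part ∅ x = C.part ∅ v)
    (hex : CubeExact (C.tensorMap R A) (C.graded 𝒜 (insert x W) j)
      (C.gradedSMul 𝒜 n (insert x W) j) (E.erase e) i) :
    CubeExact (C.tensorMap R A) (C.graded 𝒜 W j) (C.gradedSMul 𝒜 n W j) E i := by
  have hW : ∀ s ⊆ E.erase e, ∀ w ∈ W,
      C.retract e x y s (C.part (insert e s) w) = C.part s w := by
    classical
    intro s hs w hw
    rw [h.retract_part, if_neg fun hwx => hx w hw (C.part_eq_mono hs hwx)]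
  -- No edge of `E.erase e` enlarges the block of `x`. This is what makes `retract` and `posPart`
  -- commute with the cube maps.
  have hleaf' : ∀ s t, s ⊆ t → t ⊆ E.erase e → ∀ v, C.part t v = C.part t x →
      C.part s v = C.part s x := fun s t _ ht v hv =>
    (C.part_eq_mono (Finset.empty_subset s) (hleaf v (C.part_eq_mono ht hv.symm))).symm
  have hρL : ∀ s, ∀ z ∈ C.graded 𝒜 W j s,
      posPart 𝒜 (C.part s x) z ∈ C.graded 𝒜 (insert x W) j s := by
    intro s z hz
    rw [graded, Set.image_insert_eq]
    exact posPart_mem_tensorDegreePos 𝒜 _ hz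
  have hL' : ∀ s, C.graded 𝒜 (insert x W) j s ≤ C.graded 𝒜 W j s := fun s =>
    tensorDegreePos_anti 𝒜 (Set.image_mono (Set.subset_insert x W)) j
  refine CubeExact.of_section tensorMap_tensorMap
    (tensorMap_mem_graded 𝒜) hL' (fun s => Submodule.map_mono (hL' s))
    (fun s t h => map_mem_gradedSMul (tensorMap_mem_graded 𝒜 s t h)) he
    (C.tensorRetract R A e x y) (fun s => posPart 𝒜 (C.part s x))
    (fun s hs => tensorRetract_mem_graded 𝒜 (hW s hs))
    (fun s hs => map_mem_gradedSMul (C := C.contract e) (tensorRetract_mem_graded 𝒜 (hW s hs)))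
    (fun s _ => h.tensorMap_tensorRetract s) (fun s t hst ht => tensorMap_tensorRetract_comm hst
      fun v => ?_)
    (fun s _ => hρL s) (fun s _ => map_mem_gradedSMul (hρL s))
    (fun s t hst ht z hz => ?_) (fun s hs z hz => ?_) hex
  · classical
    rw [h.retract_part, h.retract_part]
    by_cases hv : C.part s v = C.part s x
    · rw [if_pos hv, if_pos (C.part_eq_mono hst hv), C.map_part]
    · rw [if_neg hv, if_neg fun hv' => hv (hleaf' s t hst ht v hv'), C.map_part]
  · rw [tensorMap, mergeMul_posPart 𝒜 _ hz, C.map_part]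
    intro c hc
    obtain ⟨v, rfl⟩ := C.part_surjective _ c
    rw [C.map_part, C.map_part] at hc
    exact hleaf' s t hst ht v hc
  · rw [tensorMap, tensorRetract, mergeMul_mergeMul]
    classical
    refine mergeMul_sub_posPart 𝒜 h𝒜 (fun c hc => ?_) ?_ hz
    · obtain ⟨v, rfl⟩ := C.part_surjective _ c
      rw [Function.comp_apply, C.map_part, h.retract_part, if_neg hc]
    · rw [Function.comp_apply, C.map_part, h.retract_part, if_pos rfl]
      exact fun hyx => hxy (C.part_eq_mono hs hyx.symm)

/-- The induction needs `C`, `W` and `i` to vary: contraction changes the cube and the position, and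
cutting a leaf enlarges `W`. -/
theorem cubeExact_of_lt {𝒜 : ℕ → Submodule R A} [GradedAlgebra 𝒜]
    (h𝒜 : 𝒜 0 ≤ Submodule.span R {1}) (n : R) {j : ℕ} (E : Finset β) :
    ∀ (C : PartitionCube V β) (W : Set V) (i : ℕ), (∀ e ∈ E, ∃ x y, C.Joins e x y) →
      i + j + (C.free W E).ncard < Nat.card (C.block ∅) →
      CubeExact (C.tensorMap R A) (C.graded 𝒜 W j) (C.gradedSMul 𝒜 n W j) E i := by
  induction hm : E.card generalizing E with
  | zero =>
    obtain rfl := Finset.card_eq_zero.1 hm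
    intro C W i _ hlt x hx _
    -- With no edges left, `hlt` says that more than `j` blocks meet `W`, and each of them requires
    -- positive degree.
    have hbot : C.graded 𝒜 W j ∅ = ⊥ := tensorDegreePos_eq_bot 𝒜 (by
      have := C.ncard_image_add_ncard_free W ∅
      omega)
    refine ⟨0, fun _ => Submodule.zero_mem _, fun s hs _ => ?_⟩
    obtain rfl := Finset.subset_empty.1 hs
    have h0 := hx ∅
    rw [hbot, Submodule.mem_bot] at h0
    rw [h0, cubeD_eq_zero (x := 0) fun _ _ => rfl, sub_zero]
    exact Submodule.zero_mem _
  | succ m ih =>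
    intro C W i hE hlt
    have hcard : ∀ e ∈ E, (E.erase e).card = m := fun e he => by
      rw [Finset.card_erase_of_mem he, hm, Nat.add_sub_cancel]
    have hE' : ∀ e, ∀ f ∈ E.erase e, ∃ x y, C.Joins f x y := fun e f hf =>
      hE f (Finset.mem_of_mem_erase hf)
    by_cases hloop : ∃ e ∈ E, ∃ x y, C.Joins e x y ∧ C.part ∅ x = C.part ∅ y
    · obtain ⟨e, he, x, y, h, hxy⟩ := hloop
      exact h.cubeExact_of_part_eq he hxy
    -- The edges whose deletion creates no new free block: non-bridges, and bridges with both sides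
    -- meeting `W`.
    by_cases hgood : ∃ e ∈ E, ∃ x y, C.Joins e x y ∧
        (C.part (E.erase e) x ≠ C.part (E.erase e) y →
          C.part (E.erase e) x ∉ C.free W (E.erase e) ∧
          C.part (E.erase e) y ∉ C.free W (E.erase e))
    · obtain ⟨e, he, x, y, h, hxy⟩ := hgood
      have hle := h.ncard_free_le hxy
      rw [Finset.insert_erase he] at hle
      refine CubeExact.of_faces tensorMap_id tensorMap_tensorMap (tensorMap_mem_graded 𝒜)
        (fun s t h => map_mem_gradedSMul (tensorMap_mem_graded 𝒜 s t h)) he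
        (ih (E.erase e) (hcard e he) C W i (hE' e) (by omega)) ?_
      rintro k rfl
      refine ih (E.erase e) (hcard e he) (C.contract e) W k (fun f hf => ?_) ?_
      · obtain ⟨a, b, hab⟩ := hE' e f hf
        exact ⟨a, b, hab.contract⟩
      · have h1 := h.card_le ∅
        have h2 : ((C.contract e).free W (E.erase e)).ncard = (C.free W E).ncard := by
          rw [← congrArg (fun s => (C.free W s).ncard) (Finset.insert_erase he)]
          rfl
        change _ < Nat.card (C.block (insert e ∅))
        omega
    · push Not at hgood
      have hbridge : ∀ e ∈ E, ∀ x y, C.Joins e x y →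
          C.part (E.erase e) x ≠ C.part (E.erase e) y := fun e he x y h =>
        (hgood e he x y h).1
      obtain ⟨e, he⟩ : E.Nonempty := Finset.card_pos.1 (by omega)
      obtain ⟨e, he, x, y, h, hx⟩ : ∃ e ∈ E, ∃ x y, C.Joins e x y ∧
          C.part (E.erase e) x ∈ C.free W (E.erase e) := by
        obtain ⟨x, y, h⟩ := hE e he
        by_cases hx : C.part (E.erase e) x ∈ C.free W (E.erase e)
        · exact ⟨e, he, x, y, h, hx⟩
        · exact ⟨e, he, y, x, h.symm, (hgood e he x y h).2 hx⟩
      -- Every edge is now a bridge with at least one side missing `W`, so a leaf missing `W`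
      -- exists.
      obtain ⟨e, he, x, y, h, hx, hleaf⟩ := exists_leaf hE hbridge _ e he x y h hx rfl
      refine h.cubeExact_of_leaf h𝒜 he (hbridge e he x y h) hx hleaf
        (ih (E.erase e) (hcard e he) C _ i (hE' e) ?_)
      have hle := h.ncard_free_le_of_free hx
      rw [Finset.insert_erase he] at hle
      omega

end PartitionCube

/-! ### Chromatic cohomology -/

/-- Subtracting the scalar part of a degree-zero element leaves a degree-zero element of `A'`, which
must vanish. -/
theorem IsPointed.degree_zero_le {R A : Type*} [CommRing R] [CommRing A] [Algebra R A]
    {𝒜 : ℕ → Submodule R A} [SetLike.GradedOne 𝒜] (hA : IsPointed 𝒜) :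
    𝒜 0 ≤ Submodule.span R {1} := by
  obtain ⟨A', hc, hA'⟩ := hA
  intro a ha
  obtain ⟨b, hb, a', ha', rfl⟩ := Submodule.mem_sup.1 (hc.sup_eq_top ▸ Submodule.mem_top (x := a))
  have hb0 : b ∈ 𝒜 0 := (Submodule.span_singleton_le_iff_mem _ _).2 (SetLike.GradedOne.one_mem) hb
  have ha'0 : a' = 0 := by
    by_contra h
    have := hA' 0 a' ha' (by simpa using Submodule.sub_mem _ ha hb0) h
    omega
  rwa [ha'0, add_zero]

section Graph

variable {α β : Type*} (G : Graph α β)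

theorem mk_eq_of_restrict_empty {a b : G.vertexSet}
    (h : (Quot.mk _ a : SpanningComponent G ∅) = Quot.mk _ b) : a = b := by
  replace h := Quot.eqvGen_exact h
  induction h with
  | rel a b h =>
    obtain ⟨e, he, -⟩ := h
    simp at he
  | refl => rfl
  | symm _ _ _ h => exact h.symm
  | trans _ _ _ _ _ h h' => exact h.trans h'

/-- The partitions of the vertex set of a graph into the components of its spanning subgraphs. -/
abbrev graphCube : PartitionCube G.vertexSet β where
  block s := SpanningComponent G s
  part _ v := Quot.mk _ v
  part_surjective _ := Quot.mk_surjective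
  map _ _ h := Component.map (G.restrict_mono_right (Finset.coe_subset.2 h))
  map_part _ _ _ _ := rfl

/-- The relation on the right of `Joins` is itself an equivalence relation, so it suffices to check
the generating adjacencies. -/
theorem graphCube_joins [DecidableEq β] {e : β} {x y : G.vertexSet}
    (h : G.IsLink e x y) : (graphCube G).Joins e x y := by
  intro s a b
  have hmono : ∀ {a b : G.vertexSet}, (graphCube G).part s a = (graphCube G).part s b →
      (graphCube G).part (insert e s) a = (graphCube G).part (insert e s) b :=
    (graphCube G).part_eq_mono (Finset.subset_insert e s)
  have hxy : (graphCube G).part (insert e s) x = (graphCube G).part (insert e s) y :=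
    Quot.sound ⟨e, by simp, h⟩
  constructor
  · intro hab
    replace hab := Quot.eqvGen_exact hab
    induction hab with
    | rel a b hab =>
      obtain ⟨f, hf, hab⟩ := hab
      rw [Finset.coe_insert, Set.mem_insert_iff] at hf
      obtain rfl | hf := hf
      · obtain ⟨h1, h2⟩ | ⟨h1, h2⟩ := hab.eq_and_eq_or_eq_and_eq h
        · obtain rfl := Subtype.ext h1
          obtain rfl := Subtype.ext h2
          exact Or.inr (Or.inl ⟨rfl, rfl⟩)
        · obtain rfl := Subtype.ext h1
          obtain rfl := Subtype.ext h2
          exact Or.inr (Or.inr ⟨rfl, rfl⟩)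
      · exact Or.inl (Quot.sound ⟨f, hf, hab⟩)
    | refl => exact Or.inl rfl
    | symm _ _ _ h =>
      obtain h | h | h := h
      · exact Or.inl h.symm
      · exact Or.inr (Or.inr h.symm)
      · exact Or.inr (Or.inl h.symm)
    | trans a b c _ _ h h' =>
      obtain h | h | h := h <;> obtain h' | h' | h' := h'
      · exact Or.inl (h.trans h')
      · exact Or.inr (Or.inl ⟨h.trans h'.1, h'.2⟩)
      · exact Or.inr (Or.inr ⟨h.trans h'.1, h'.2⟩)
      · exact Or.inr (Or.inl ⟨h.1, h'.symm.trans h.2⟩)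
      · exact Or.inr (Or.inl ⟨h.1, h'.2⟩)
      · exact Or.inl (h.1.trans h'.2.symm)
      · exact Or.inr (Or.inr ⟨h.1, h'.symm.trans h.2⟩)
      · exact Or.inl (h.1.trans h'.2.symm)
      · exact Or.inr (Or.inr ⟨h.1, h'.2⟩)
  · rintro (hab | ⟨ha, hb⟩ | ⟨ha, hb⟩)
    · exact hmono hab
    · exact (hmono ha).trans (hxy.trans (hmono hb).symm)
    · exact (hmono ha).trans (hxy.symm.trans (hmono hb).symm)

variable {R A : Type*} [CommRing R] [CommRing A] [Algebra R A] [Finite G.vertexSet]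

variable {G} in
theorem mem_homogeneousCochains {𝒜 : ℕ → Submodule R A} {i j : ℕ} {x : Cochain R A G i} :
    x ∈ homogeneousCochains 𝒜 G i j ↔ ∀ s, x s ∈ (graphCube G).graded 𝒜 ∅ j s.1 := by
  have h : ∀ s, (graphCube G).graded 𝒜 ∅ j s = tensorDegree 𝒜 (SpanningComponent G s) j := by
    intro s
    rw [PartitionCube.graded, Set.image_empty]
    exact tensorDegreePos_empty 𝒜 j
  simp only [h, homogeneousCochains, Submodule.mem_pi, Set.mem_univ, forall_true_left]

variable [LinearOrder β]

/-! ### From the cube back to the cochain complex of the graph. -/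

theorem differential_eq_cubeD {i : ℕ} {x : Cochain R A G i}
    {y : ∀ s : Finset β, ⨂[R] _ : SpanningComponent G s, A} (h : ∀ s, x s = y s.1)
    (t : EdgeSubset G (i + 1)) :
    differential R A G i x t = cubeD ((graphCube G).tensorMap R A) y t.1 := by
  rw [differential_apply]
  refine Finset.sum_congr rfl fun e _ => ?_
  rw [h]
  rfl

/-- A vanishing theorem for the chromatic cohomology with coefficients in `R ⧸ n`. -/
theorem exists_coboundary_add_smul [Finite G.edgeSet] {𝒜 : ℕ → Submodule R A} [GradedAlgebra 𝒜]
    (h𝒜 : 𝒜 0 ≤ Submodule.span R {1}) {i j : ℕ}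
    (hlt : i + j + Nat.card (Component G) < Nat.card G.vertexSet) {n : R} {x : Cochain R A G i}
    (hx : x ∈ homogeneousCochains 𝒜 G i j) {u : Cochain R A G (i + 1)}
    (hu : u ∈ homogeneousCochains 𝒜 G (i + 1) j) (hxu : differential R A G i x = n • u) :
    ∃ c ∈ coboundaries 𝒜 G i j, ∃ w ∈ homogeneousCochains 𝒜 G i j, x = c + n • w := by
  classical
  have hfin : (G.edgeSet).Finite := Set.toFinite _
  set E : Finset β := hfin.toFinset with hE
  have hEcoe : (E : Set β) = G.edgeSet := hfin.coe_toFinset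
  have hcube := PartitionCube.cubeExact_of_lt h𝒜 n (j := j) E (graphCube G) ∅ i (by
    intro e he
    obtain ⟨x, y, h⟩ := G.exists_isLink_of_mem_edgeSet (hfin.mem_toFinset.1 he)
    exact ⟨⟨x, h.left_mem⟩, ⟨y, h.right_mem⟩, graphCube_joins G h⟩) (by
    have h1 : ((graphCube G).free ∅ E).ncard ≤ Nat.card (Component G) := by
      have h2 : G.restrict (E : Set β) = G := by rw [hEcoe, G.restrict_self]
      rw [← congrArg (fun H => Nat.card (Component H)) h2, ← Set.ncard_univ]
      exact Set.ncard_le_ncard (Set.subset_univ _) (Set.toFinite _)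
    have h2 : Nat.card G.vertexSet ≤ Nat.card ((graphCube G).block ∅) :=
      Nat.card_le_card_of_injective ((graphCube G).part ∅) fun _ _ => mk_eq_of_restrict_empty G
    omega)
  -- Extension by zero: a cochain lives on sets of `i` edges of `G`, whereas the cube is indexed by
  -- all finite sets.
  let X : ∀ s : Finset β, ⨂[R] _ : SpanningComponent G s, A := fun s =>
    if h : (s : Set β) ⊆ G.edgeSet ∧ s.card = i then x ⟨s, h⟩ else 0
  have hX : ∀ s : EdgeSubset G i, x s = X s.1 := fun s => by
    dsimp only [X]
    rw [dif_pos s.2]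
  have hsub : ∀ {s : Finset β}, s ⊆ E → (s : Set β) ⊆ G.edgeSet := fun h =>
    hEcoe ▸ Finset.coe_subset.2 h
  obtain ⟨y, hyL, hy⟩ := hcube X (fun s => by
    dsimp only [X]
    split_ifs with h
    · exact mem_homogeneousCochains.1 hx ⟨s, h⟩
    · exact Submodule.zero_mem _) (fun t ht htc => by
    rw [← differential_eq_cubeD G hX ⟨t, hsub ht, htc⟩, hxu]
    exact ⟨_, mem_homogeneousCochains.1 hu ⟨t, hsub ht, htc⟩, rfl⟩)
  have hw : ∀ s : EdgeSubset G i, ∃ w ∈ (graphCube G).graded 𝒜 ∅ j s.1,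
      n • w = X s.1 - cubeD ((graphCube G).tensorMap R A) y s.1 := fun s =>
    hy s.1 (Finset.coe_subset.1 (s.2.1.trans hEcoe.ge)) s.2.2
  choose w hwL hw using hw
  refine ⟨fun s => cubeD ((graphCube G).tensorMap R A) y s.1, ?_, w,
    mem_homogeneousCochains.2 hwL, ?_⟩
  · obtain _ | k := i
    -- In position `0` the differential at the empty set is an empty sum, which matches the absence
    -- of coboundaries.
    · refine (Submodule.mem_bot R).2 (funext fun s => cubeD_eq_zero fun f hf => ?_)
      rw [Finset.card_eq_zero.1 s.2.2] at hf
      exact absurd hf (Finset.notMem_empty f)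
    · exact ⟨fun s => y s.1, mem_homogeneousCochains.2 fun s => hyL s.1,
        funext fun t => differential_eq_cubeD G (fun _ => rfl) t⟩
  · funext s
    rw [Pi.add_apply, Pi.smul_apply, hw, ← hX, add_sub_cancel]

/-- Vanishing modulo `n` is applied to a primitive of `n • x`. It lies in position `i - 1`, which is
why equality is allowed in `hle`. -/
theorem mem_coboundaries_of_smul_mem [Finite G.edgeSet] [IsDomain R] [Module.Free R A]
    {𝒜 : ℕ → Submodule R A} [GradedAlgebra 𝒜] (h𝒜 : 𝒜 0 ≤ Submodule.span R {1}) {i j : ℕ}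
    (hle : i + j + Nat.card (Component G) ≤ Nat.card G.vertexSet) {n : R} (hn : n ≠ 0)
    {x : Cochain R A G i} (hx : x ∈ homogeneousCochains 𝒜 G i j)
    (hnx : n • x ∈ coboundaries 𝒜 G i j) : x ∈ coboundaries 𝒜 G i j := by
  have hfree : ∀ s : Finset β, Module.Free R (⨂[R] _ : SpanningComponent G s, A) := fun s =>
    Module.Free.of_basis (Basis.piTensorProduct fun _ => Module.Free.chooseBasis R A)
  obtain _ | k := i
  · refine (Submodule.mem_bot R).2 ((smul_eq_zero_iff_right hn).1 ((Submodule.mem_bot R).1 hnx))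
  · obtain ⟨y, hy, hyx⟩ := hnx
    obtain ⟨c, hc, w, hw, rfl⟩ := exists_coboundary_add_smul G h𝒜 (by omega) hy hx hyx
    have hc0 := (coboundaries_le_cocycles 𝒜 G k j hc).2
    refine ⟨w, hw, ?_⟩
    -- The cocycle part of the primitive drops out, so `n` times the differential of `w` is `n • x`,
    -- and `n` cancels.
    rw [map_add, LinearMap.mem_ker.1 hc0, zero_add, map_smul] at hyx
    exact smul_right_injective _ hn hyx

end Graph

end ChromaticCohomology

end

theorem mainTheorem3 {α β A : Type*} [LinearOrder β] (G : Graph α β)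
    [Finite G.vertexSet] [Finite G.edgeSet] [CommRing A]
    (𝒜 : ℕ → Submodule ℤ A) [GradedAlgebra 𝒜]
    [∀ n, Module.Free ℤ (𝒜 n)] [∀ n, Module.Finite ℤ (𝒜 n)]
    (hA : ChromaticCohomology.IsPointed 𝒜)
    (v μ : ℕ) (hv : Nat.card G.vertexSet = v)
    (hμ : Nat.card (ChromaticCohomology.Component G) = μ) (i j : ℕ) :
    (Nontrivial (ChromaticCohomology.Cohomology 𝒜 G i j) → (v : ℤ) - μ ≤ i + j) ∧
    (Submodule.torsion ℤ (ChromaticCohomology.Cohomology 𝒜 G i j) ≠ ⊥ →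
      (v : ℤ) - μ + 1 ≤ i + j) := by
  subst hv hμ
  constructor
  · intro hnt
    by_contra hlt
    refine (Submodule.Quotient.nontrivial_iff.1 hnt) (Submodule.comap_subtype_eq_top.2 fun x hx => ?_)
    -- With `n = 0`, working modulo `n` is no restriction and the statement is plain vanishing.
    obtain ⟨c, hc, w, -, rfl⟩ := ChromaticCohomology.exists_coboundary_add_smul G
      hA.degree_zero_le (n := 0) (by omega) hx.1 (Submodule.zero_mem _)
      (by rw [LinearMap.mem_ker.1 hx.2, smul_zero])
    rwa [zero_smul, add_zero]
  · intro htor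
    by_contra hlt
    -- Freeness passes from the graded pieces to their direct sum.
    have hfree : Module.Free ℤ A :=
      Module.Free.of_equiv (DirectSum.decomposeLinearEquiv 𝒜).symm
    refine htor ((Submodule.eq_bot_iff _).2 fun x hx => ?_)
    obtain ⟨n, hn⟩ := (Submodule.mem_torsion_iff x).1 hx
    obtain ⟨x, rfl⟩ := Submodule.Quotient.mk_surjective _ x
    have hn' : (n : ℤ) • x ∈ (ChromaticCohomology.coboundaries 𝒜 G i j).submoduleOf
        (ChromaticCohomology.cocycles 𝒜 G i j) := (Submodule.Quotient.mk_eq_zero _).1 hn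
    exact (Submodule.Quotient.mk_eq_zero _).2 (ChromaticCohomology.mem_coboundaries_of_smul_mem G
      hA.degree_zero_le (by omega) (nonZeroDivisors.ne_zero n.2) x.2.1 hn')
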